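/- **Theorem (Global convergence for continuous-time mixed $\mathcal H_2/\mathcal H_\infty$ design).** Consider the linear system $\dot x=Ax+Bu+Dw$, $z=Cx+Eu$ with state $x\in\mathbb R^m$, control $u\in\mathbb R^d$, disturbance $w\in\mathbb R^n$, output $z\in\mathbb R^l$, where $E^\top[\,C\ \ E\,]=[\,0\ \ R\,]$ with $R>0$, and let $\gamma>0$. For a gain $K\in\mathbb R^{d\times m}$ (control $u=-Kx$) let $\mathcal T(K)(s)=(C-EK)(sI-A+BK)^{-1}D$ be the closed-loop transfer function from $w$ to $z$, let $\|\mathcal T(K)\|_\infty=\sup_{\omega\in\mathbb R}\sigma_{\max}\big(\mathcal T(K)(i\omega)\big)$, and let $$\mathcal K=\{K:\ A-BK\text{ is Hurwitz and }\|\mathcal T(K)\|_\infty<\gamma\}.$$ For $K\in\mathcal K$ let $P_K\ge 0$ be the unique symmetric solution of $$(A-BK)^\top P+P(A-BK)+C^\top C+K^\top RK+\gamma^{-2}PDD^\top P=0$$ for which $A-BK+\gamma^{-2}DD^\top P$ is Hurwitz, and let $\mathcal J(K)=\operatorname{tr}(P_KDD^\top)$. Suppose $K_0\in\mathcal K$ and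 $(A,C)$ is detectable. Then there is a gain $K^*\in\mathcal K$ that minimizes $\mathcal J$ over $\mathcal K$ and satisfies $K^*=R^{-1}B^\top P_{K^*}$; it is the only gain in $\mathcal K$ satisfying this equation. Moreover, let $(K_k)_{k\ge0}$ be generated from $K_0$ either by the natural policy gradient method $$K_{k+1}=K_k-2\eta\,(RK_k-B^\top P_{K_k})\quad\text{with a constant stepsize } \eta>0,\ 2\eta\|R\|\le 1,$$ or by the Gauss–Newton method $$K_{k+1}=K_k-2\eta\,(K_k-R^{-1}B^\top P_{K_k})\quad\text{with a constant stepsize } 0<\eta\le\tfrac12 .$$ Then $K_k\in\mathcal K$ for all $k$ (so $P_{K_k}$ is well defined), $K_k\to K^*$, and there is a constant $c$, independent of $N$, such that for all $N\ge1$ $$\frac1N\sum_{k=0}^{N-1}\big\|RK_k-B^\top P_{K_k}\big\|_F^2\le\frac cN .$$ Here $\|R\|$ is the operator norm and $\|\cdot\|_F$ the Frobenius norm. -/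

import Mathlib

open scoped Matrix

namespace MixedDesign

open scoped Matrix.Norms.L2Operator in
/-- The operator norm (largest singular value) of a real or complex matrix. -/
noncomputable def opNorm {𝕜 : Type*} [RCLike 𝕜] {p q : ℕ} (M : Matrix (Fin p) (Fin q) 𝕜) : ℝ :=
  ‖M‖

open scoped Matrix.Norms.L2Operator in
theorem opNorm_nonneg {𝕜 : Type*} [RCLike 𝕜] {p q : ℕ} (M : Matrix (Fin p) (Fin q) 𝕜) :
    0 ≤ opNorm M :=
  norm_nonneg M

/-- The squared Frobenius norm of a real matrix. -/
def frobSq {p q : ℕ} (M : Matrix (Fin p) (Fin q) ℝ) : ℝ :=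
  ∑ i, ∑ j, M i j ^ 2

/-- A real matrix, read as a complex matrix. -/
def toC {p q : ℕ} (M : Matrix (Fin p) (Fin q) ℝ) : Matrix (Fin p) (Fin q) ℂ :=
  M.map (fun x : ℝ => (x : ℂ))

/-- A real square matrix is Hurwitz if all its complex eigenvalues have negative real part. -/
def IsHurwitz {p : ℕ} (M : Matrix (Fin p) (Fin p) ℝ) : Prop :=
  ∀ z ∈ spectrum ℂ (toC M), z.re < 0

/-- Detectability of a pair `(A, C)`: some output injection makes `A` Hurwitz. -/
def IsDetectable {m l : ℕ} (A : Matrix (Fin m) (Fin m) ℝ) (C : Matrix (Fin l) (Fin m) ℝ) : Prop :=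
  ∃ L : Matrix (Fin m) (Fin l) ℝ, IsHurwitz (A - L * C)

/-- The transfer function `s ↦ H (s I - F)⁻¹ G` of `ẋ = F x + G w`, `z = H x`. -/
noncomputable def transferFunction {m n l : ℕ} (F : Matrix (Fin m) (Fin m) ℝ)
    (G : Matrix (Fin m) (Fin n) ℝ) (H : Matrix (Fin l) (Fin m) ℝ) (s : ℂ) :
    Matrix (Fin l) (Fin n) ℂ :=
  toC H * (s • (1 : Matrix (Fin m) (Fin m) ℂ) - toC F)⁻¹ * toC G

/-- The continuous-time `H_∞` norm: the supremum over real frequencies `ω` of the largest singular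
value of `T (i ω)`, as an extended nonnegative real. -/
noncomputable def hInfNorm {n l : ℕ} (T : ℂ → Matrix (Fin l) (Fin n) ℂ) : ENNReal :=
  ⨆ ω : ℝ, ENNReal.ofReal (opNorm (T ((ω : ℂ) * Complex.I)))

/-- The data of a mixed `H_2/H_∞` state-feedback design problem: the plant
`ẋ = A x + B u + D w`, `z = C x + E u`, and the attenuation level `γ`. -/
structure Problem (m d n l : ℕ) where
  /-- state matrix -/
  A : Matrix (Fin m) (Fin m) ℝ
  /-- control matrix -/
  B : Matrix (Fin m) (Fin d) ℝ
  /-- state-to-output matrix -/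
  C : Matrix (Fin l) (Fin m) ℝ
  /-- disturbance matrix -/
  D : Matrix (Fin m) (Fin n) ℝ
  /-- control-to-output matrix -/
  E : Matrix (Fin l) (Fin d) ℝ
  /-- attenuation level -/
  γ : ℝ

namespace Problem

variable {m d n l : ℕ} (S : Problem m d n l)

/-- The control weight `R = Eᵀ E`. -/
def R : Matrix (Fin d) (Fin d) ℝ := S.Eᵀ * S.E

/-- The standing assumption on the data: `γ > 0` and `Eᵀ [C  E] = [0  R]` with `R > 0`. -/
def Standing : Prop := 0 < S.γ ∧ S.Eᵀ * S.C = 0 ∧ S.R.PosDef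

/-- The closed-loop transfer function from `w` to `z` under `u = - K x`. -/
noncomputable def closedLoop (K : Matrix (Fin d) (Fin m) ℝ) : ℂ → Matrix (Fin l) (Fin n) ℂ :=
  transferFunction (S.A - S.B * K) S.D (S.C - S.E * K)

/-- The feasible set: the stabilizing gains with closed-loop `H_∞` norm less than `γ`. -/
def feasible : Set (Matrix (Fin d) (Fin m) ℝ) :=
  {K | IsHurwitz (S.A - S.B * K) ∧ hInfNorm (S.closedLoop K) < ENNReal.ofReal S.γ}

/-- `P` is a stabilizing positive semidefinite solution of the closed-loop Riccati equation
of the gain `K`. -/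
def IsStabilizingSolution (K : Matrix (Fin d) (Fin m) ℝ) (P : Matrix (Fin m) (Fin m) ℝ) : Prop :=
  P.PosSemidef ∧
  (S.A - S.B * K)ᵀ * P + P * (S.A - S.B * K) + S.Cᵀ * S.C + Kᵀ * S.R * K
      + (S.γ ^ 2)⁻¹ • (P * S.D * S.Dᵀ * P) = 0 ∧
  IsHurwitz (S.A - S.B * K + (S.γ ^ 2)⁻¹ • (S.D * S.Dᵀ * P))

open Classical in
/-- The stabilizing solution `P_K` of the Riccati equation (it is unique, see
`IsStabilizingSolution.unique`), with the value `0` if there is none. -/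
noncomputable def ricc (K : Matrix (Fin d) (Fin m) ℝ) : Matrix (Fin m) (Fin m) ℝ :=
  if h : ∃ P, S.IsStabilizingSolution K P then h.choose else 0

/-- The cost `J(K) = tr (P_K D Dᵀ)`. -/
noncomputable def cost (K : Matrix (Fin d) (Fin m) ℝ) : ℝ :=
  (S.ricc K * S.D * S.Dᵀ).trace

/-- One natural policy gradient step `K ↦ K - 2 η (R K - Bᵀ P_K)`. -/
noncomputable def npgStep (η : ℝ) (K : Matrix (Fin d) (Fin m) ℝ) : Matrix (Fin d) (Fin m) ℝ :=
  K - (2 * η) • (S.R * K - S.Bᵀ * S.ricc K)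

/-- One Gauss-Newton step `K ↦ K - 2 η (K - R⁻¹ Bᵀ P_K)`. -/
noncomputable def gnStep (η : ℝ) (K : Matrix (Fin d) (Fin m) ℝ) : Matrix (Fin d) (Fin m) ℝ :=
  K - (2 * η) • (K - S.R⁻¹ * S.Bᵀ * S.ricc K)

/-- The conclusion on one sequence of gains: every gain is feasible (and its Riccati equation is
solved by `P_K`), the gains converge to `Kstar`, and the average of `‖R K_n - Bᵀ P_{K_n}‖_F²` over
`n < N` is at most a constant times `1 / N`. -/
def ConvergesWithRate (Kseq : ℕ → Matrix (Fin d) (Fin m) ℝ) (Kstar : Matrix (Fin d) (Fin m) ℝ) :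
    Prop :=
  (∀ k, Kseq k ∈ S.feasible ∧ S.IsStabilizingSolution (Kseq k) (S.ricc (Kseq k))) ∧
  Filter.Tendsto Kseq Filter.atTop (nhds Kstar) ∧
  ∃ c : ℝ, ∀ N : ℕ, 1 ≤ N →
    (1 / (N : ℝ)) * ∑ k ∈ Finset.range N, frobSq (S.R * Kseq k - S.Bᵀ * S.ricc (Kseq k))
      ≤ c * (1 / (N : ℝ))

end Problem

theorem toC_mul {p q r : ℕ} (M : Matrix (Fin p) (Fin q) ℝ) (N : Matrix (Fin q) (Fin r) ℝ) :
    toC (M * N) = toC M * toC N :=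
  Matrix.map_mul (f := Complex.ofRealHom)

theorem toC_conjTranspose {p q : ℕ} (M : Matrix (Fin p) (Fin q) ℝ) : (toC M)ᴴ = toC Mᵀ := by
  ext i j
  simp [toC]

/-- Only the Gram matrix `Hᵀ H` of the output matrix matters for the `H_∞` norm; so `H` may be
replaced by `(Hᵀ H)^{1/2}`. -/
theorem hInfNorm_congr_gram {m n l l' : ℕ} (F : Matrix (Fin m) (Fin m) ℝ)
    (G : Matrix (Fin m) (Fin n) ℝ) (H : Matrix (Fin l) (Fin m) ℝ) (H' : Matrix (Fin l') (Fin m) ℝ)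
    (h : Hᵀ * H = H'ᵀ * H') :
    hInfNorm (transferFunction F G H) = hInfNorm (transferFunction F G H') := by
  have key : ∀ s : ℂ, opNorm (transferFunction F G H s) = opNorm (transferFunction F G H' s) := by
    intro s
    have e : (transferFunction F G H s)ᴴ * transferFunction F G H s
        = (transferFunction F G H' s)ᴴ * transferFunction F G H' s := by
      have h2 : (toC H)ᴴ * toC H = (toC H')ᴴ * toC H' := by
        rw [toC_conjTranspose, toC_conjTranspose, ← toC_mul, ← toC_mul, h]
      simp only [transferFunction, Matrix.conjTranspose_mul, Matrix.mul_assoc]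
      rw [← Matrix.mul_assoc (toC H)ᴴ, ← Matrix.mul_assoc (toC H')ᴴ, h2]
    have h1 := Matrix.l2_opNorm_conjTranspose_mul_self (transferFunction F G H s)
    have h2 := Matrix.l2_opNorm_conjTranspose_mul_self (transferFunction F G H' s)
    rw [e, h2] at h1
    have h3 := mul_self_inj_of_nonneg (a := opNorm (transferFunction F G H' s))
      (b := opNorm (transferFunction F G H s)) (opNorm_nonneg _) (opNorm_nonneg _)
    exact (h3.1 h1).symm
  simp only [hInfNorm, key]

/-- Under the standing assumption, the closed-loop output matrix has Gram matrix
`Cᵀ C + Kᵀ R K`. -/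
theorem Problem.gram_output {m d n l : ℕ} (S : Problem m d n l) (hS : S.Standing)
    (K : Matrix (Fin d) (Fin m) ℝ) :
    (S.C - S.E * K)ᵀ * (S.C - S.E * K) = S.Cᵀ * S.C + Kᵀ * S.R * K := by
  have h1 : S.Eᵀ * S.C = 0 := hS.2.1
  have h2 : S.Cᵀ * S.E = 0 := by
    have := congrArg Matrix.transpose h1
    simpa using this
  have h3 : S.Cᵀ * (S.E * K) = 0 := by rw [← Matrix.mul_assoc, h2, Matrix.zero_mul]
  simp [Matrix.sub_mul, Matrix.mul_sub, Matrix.mul_assoc, h1, h3, Problem.R]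

/-- If `F₁` and `F₂` are Hurwitz, the Sylvester equation `F₁ᵀ X + X F₂ = 0` has only the zero
solution. -/
theorem sylvester_zero {m : ℕ} {F₁ F₂ X : Matrix (Fin m) (Fin m) ℝ} (h₁ : IsHurwitz F₁)
    (h₂ : IsHurwitz F₂) (h : F₁ᵀ * X + X * F₂ = 0) : X = 0 := by
  rcases Nat.eq_zero_or_pos m with rfl | hm
  · exact Subsingleton.elim _ _
  set a := toC F₂ with ha
  set b := toC F₁ᵀ with hb
  set x := toC X with hx
  have e : x * a = -b * x := by
    have h' := congrArg toC (eq_neg_of_add_eq_zero_right h)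
    rw [toC_mul] at h'
    rw [h', hb, hx, neg_mul, ← toC_mul]
    ext i j
    simp [toC]
  have ep : ∀ p : Polynomial ℂ, x * Polynomial.aeval a p = Polynomial.aeval (-b) p * x := by
    intro p
    induction p using Polynomial.induction_on' with
    | add p q hp hq => simp [mul_add, add_mul, hp, hq]
    | monomial k c =>
      have hk : x * a ^ k = (-b) ^ k * x := (show SemiconjBy x a (-b) from e).pow_right k
      simp only [Polynomial.aeval_monomial, ← Algebra.smul_def, mul_smul_comm, smul_mul_assoc, hk]
  have e0 : Polynomial.aeval (-b) a.charpoly * x = 0 := by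
    rw [← ep, Matrix.aeval_self_charpoly, mul_zero]
  have hu : IsUnit (Polynomial.aeval (-b) a.charpoly) := by
    rw [← spectrum.zero_notMem_iff ℂ]
    have hd : 0 < a.charpoly.degree := by
      rw [Matrix.charpoly_degree_eq_dim]
      simpa using hm
    rw [spectrum.map_polynomial_aeval_of_degree_pos _ _ hd]
    rintro ⟨z, hz, hz0⟩
    have hz2 : z ∈ spectrum ℂ a := Matrix.mem_spectrum_iff_isRoot_charpoly.2 hz0
    have hz3 : -z ∈ spectrum ℂ b := by
      rw [← spectrum.neg_eq] at hz
      simpa using hz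
    have hz4 : -z ∈ spectrum ℂ (toC F₁) := by
      rw [Matrix.mem_spectrum_iff_isRoot_charpoly] at hz3 ⊢
      have : b = (toC F₁)ᵀ := by
        ext i j
        simp [hb, toC]
      rwa [this, Matrix.charpoly_transpose] at hz3
    have r1 := h₂ z hz2
    have r2 := h₁ (-z) hz4
    simp only [Complex.neg_re] at r2
    linarith
  have x0 : x = 0 := (hu.mul_right_eq_zero).1 e0
  ext i j
  have := congrFun (congrFun x0 i) j
  simpa [hx, toC] using this

theorem Problem.IsStabilizingSolution.unique {m d n l : ℕ} {S : Problem m d n l}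
    {K : Matrix (Fin d) (Fin m) ℝ} {P Q : Matrix (Fin m) (Fin m) ℝ}
    (hP : S.IsStabilizingSolution K P) (hQ : S.IsStabilizingSolution K Q) : P = Q := by
  obtain ⟨hP1, hP2, hP3⟩ := hP
  obtain ⟨hQ1, hQ2, hQ3⟩ := hQ
  have hPt : Pᵀ = P := by simpa using hP1.isHermitian.eq
  refine sub_eq_zero.1 (sylvester_zero hP3 hQ3 ?_)
  rw [← sub_eq_zero.2 (hP2.trans hQ2.symm)]
  simp only [Matrix.transpose_add, Matrix.transpose_sub, Matrix.transpose_mul, Matrix.transpose_smul,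
    Matrix.transpose_transpose, hPt, Matrix.add_mul, Matrix.mul_add, Matrix.sub_mul, Matrix.mul_sub,
    Matrix.smul_mul, Matrix.mul_smul, Matrix.mul_assoc, smul_sub]
  abel

theorem Problem.ricc_eq {m d n l : ℕ} {S : Problem m d n l} {K : Matrix (Fin d) (Fin m) ℝ}
    {P : Matrix (Fin m) (Fin m) ℝ} (hP : S.IsStabilizingSolution K P) : S.ricc K = P := by
  have h : ∃ P, S.IsStabilizingSolution K P := ⟨P, hP⟩
  rw [Problem.ricc, dif_pos h]
  exact h.choose_spec.unique hP

end MixedDesign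

/-! Put `G = γ⁻¹ D`, so that `P_K` is the stabilizing solution of a Riccati equation with quadratic
term `P G Gᵀ P`. The strict bounded real lemma makes feasibility of `K` equivalent to the existence
of `P_K`. Existence for a feasible gain comes from continuation: the factor `t` in `t G Gᵀ` is moved
from 0 (a Lyapunov equation) to 1, the strict frequency bound keeping eigenvalues off the imaginary
axis (`FreqBound.exists_stabRicc`). Conversely, a dissipation inequality with a suitable equality
case gives stability and a norm below `γ` (`Problem.mem_feasible_of_dissipation`).

Both methods are steps `K' = K - c T E` with `E = R K - Bᵀ P_K`, where `T = 1` or `T = R⁻¹`.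
Completing the square shows that `P_K` solves the Riccati equation of `K'` up to a residual `M ≥ 0`;
the stepsize condition is exactly `T - c T R T ≥ 0`. Hence `K'` is feasible and `P_{K'} ≤ P_K`, and
`tr M`, which dominates a multiple of `‖E‖²`, is controlled by the decrease of `P`
(`Problem.step_spec`). The decreasing matrices `P_{K_k}` converge, the sum of `‖E_k‖²` telescopes,
and the gains converge to a stationary gain.

The limit might lie on the boundary of the feasible set. This is excluded by
`Problem.eq_zero_of_stationary`: an imaginary closed-loop mode at a stationary gain either is an
unobservable mode, against detectability, or gives a worst-case response of energy gain 1 that is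
optimal among all controls, against the gain below 1 achieved by `K₀`. Stationary gains are unique
by a Sylvester equation. Global minimality follows without convexity: Gauss–Newton started at any
feasible `K` descends to the same stationary gain, so `P_{K*} ≤ P_K`. -/

namespace MixedDesign

/-! ### Complex eigenvectors in real coordinates -/

/-- The real `2 × 2` matrix by which the complex number `σ + i ω` acts on the pair `(Re v, Im v)`,
a complex vector `v` being read as the two-column real matrix with columns `Re v` and `Im v`. -/
def cplx (σ ω : ℝ) : Matrix (Fin 2) (Fin 2) ℝ := !![σ, ω; -ω, σ]

/-- The two-column real matrix with columns `Re v` and `Im v`. -/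
def reIm {p : ℕ} (v : Fin p → ℂ) : Matrix (Fin p) (Fin 2) ℝ :=
  Matrix.of fun i => ![(v i).re, (v i).im]

/-- The complex vector with real and imaginary part the columns of `X`. -/
noncomputable def ofReIm {p : ℕ} (X : Matrix (Fin p) (Fin 2) ℝ) : Fin p → ℂ :=
  fun i => ⟨X i 0, X i 1⟩

theorem reIm_ofReIm {p : ℕ} (X : Matrix (Fin p) (Fin 2) ℝ) : reIm (ofReIm X) = X := by
  ext i j
  fin_cases j <;> simp [reIm, ofReIm]

theorem ofReIm_reIm {p : ℕ} (v : Fin p → ℂ) : ofReIm (reIm v) = v := by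
  ext i
  simp [reIm, ofReIm]

theorem reIm_zero {p : ℕ} : reIm (0 : Fin p → ℂ) = 0 := by
  ext i j
  fin_cases j <;> simp [reIm]

theorem reIm_add {p : ℕ} (v w : Fin p → ℂ) : reIm (v + w) = reIm v + reIm w := by
  ext i j
  fin_cases j <;> simp [reIm]

theorem reIm_injective {p : ℕ} : Function.Injective (reIm (p := p)) := fun v w h => by
  rw [← ofReIm_reIm v, h, ofReIm_reIm]

theorem reIm_eq_zero_iff {p : ℕ} {v : Fin p → ℂ} : reIm v = 0 ↔ v = 0 := by
  rw [← reIm_zero, reIm_injective.eq_iff]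

theorem reIm_mulVec {p q : ℕ} (M : Matrix (Fin p) (Fin q) ℝ) (v : Fin q → ℂ) :
    reIm (toC M *ᵥ v) = M * reIm v := by
  ext i j
  fin_cases j <;> simp [reIm, toC, Matrix.mul_apply, Matrix.mulVec, dotProduct]

theorem reIm_smul {p : ℕ} (z : ℂ) (v : Fin p → ℂ) :
    reIm (z • v) = reIm v * cplx z.re z.im := by
  ext i j
  fin_cases j <;> simp [reIm, cplx, Matrix.mul_apply] <;> ring

theorem mem_spectrum_iff_mulVec {p : ℕ} {M : Matrix (Fin p) (Fin p) ℂ} {z : ℂ} :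
    z ∈ spectrum ℂ M ↔ ∃ v : Fin p → ℂ, v ≠ 0 ∧ M *ᵥ v = z • v := by
  rw [spectrum.mem_iff, Matrix.isUnit_iff_isUnit_det, isUnit_iff_ne_zero, not_not,
    ← Matrix.exists_mulVec_eq_zero_iff]
  refine exists_congr fun v => and_congr_right fun _ => ?_
  rw [Matrix.sub_mulVec, sub_eq_zero, Algebra.algebraMap_eq_smul_one, Matrix.smul_mulVec,
    Matrix.one_mulVec]
  exact eq_comm

theorem mem_spectrum_toC_iff {p : ℕ} {F : Matrix (Fin p) (Fin p) ℝ} {z : ℂ} :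
    z ∈ spectrum ℂ (toC F) ↔
      ∃ X : Matrix (Fin p) (Fin 2) ℝ, X ≠ 0 ∧ F * X = X * cplx z.re z.im := by
  rw [mem_spectrum_iff_mulVec]
  constructor
  · rintro ⟨v, hv, h⟩
    exact ⟨reIm v, mt reIm_eq_zero_iff.1 hv, by rw [← reIm_mulVec, h, reIm_smul]⟩
  · rintro ⟨X, hX, h⟩
    refine ⟨ofReIm X, fun h0 => hX ?_, reIm_injective ?_⟩
    · rw [← reIm_ofReIm X, h0, reIm_zero]
    · rw [reIm_mulVec, reIm_smul, reIm_ofReIm, h]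

/-- Eigenvectors become two-column real matrices, so that all later energy arguments are trace
identities between real matrices. -/
theorem isHurwitz_iff {p : ℕ} {F : Matrix (Fin p) (Fin p) ℝ} :
    IsHurwitz F ↔ ∀ (σ ω : ℝ) (X : Matrix (Fin p) (Fin 2) ℝ), F * X = X * cplx σ ω → 0 ≤ σ →
      X = 0 := by
  constructor
  · intro h σ ω X hX hσ
    by_contra h0
    have := h ⟨σ, ω⟩ (mem_spectrum_toC_iff.2 ⟨X, h0, hX⟩)
    exact absurd hσ (not_le.2 this)
  · intro h z hz
    obtain ⟨X, h0, hX⟩ := mem_spectrum_toC_iff.1 hz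
    by_contra hlt
    exact h0 (h _ _ X hX (not_lt.1 hlt))

/-! ### Traces and positive semidefinite matrices -/

theorem trace_transpose_mul_comm {p q : ℕ} (X Y : Matrix (Fin p) (Fin q) ℝ) :
    (Xᵀ * Y).trace = (Yᵀ * X).trace := by
  rw [← Matrix.trace_transpose]
  simp

theorem frobSq_eq_trace {p q : ℕ} (X : Matrix (Fin p) (Fin q) ℝ) : frobSq X = (Xᵀ * X).trace := by
  rw [frobSq, Finset.sum_comm]
  simp [Matrix.trace, Matrix.mul_apply, sq]

theorem frobSq_nonneg {p q : ℕ} (X : Matrix (Fin p) (Fin q) ℝ) : 0 ≤ frobSq X :=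
  Finset.sum_nonneg fun _ _ => Finset.sum_nonneg fun _ _ => sq_nonneg _

theorem frobSq_eq_zero_iff {p q : ℕ} {X : Matrix (Fin p) (Fin q) ℝ} : frobSq X = 0 ↔ X = 0 := by
  rw [frobSq_eq_trace, ← Matrix.conjTranspose_eq_transpose_of_trivial,
    Matrix.trace_conjTranspose_mul_self_eq_zero_iff]

theorem PosSemidef.transpose_eq {p : ℕ} {M : Matrix (Fin p) (Fin p) ℝ} (hM : M.PosSemidef) :
    Mᵀ = M := by
  simpa using hM.isHermitian.eq

theorem PosSemidef.congr {p q : ℕ} {M : Matrix (Fin p) (Fin p) ℝ} (hM : M.PosSemidef)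
    (X : Matrix (Fin p) (Fin q) ℝ) : (Xᵀ * M * X).PosSemidef := by
  simpa using hM.conjTranspose_mul_mul_same X

theorem PosSemidef.trace_congr_nonneg {p q : ℕ} {M : Matrix (Fin p) (Fin p) ℝ}
    (hM : M.PosSemidef) (X : Matrix (Fin p) (Fin q) ℝ) : 0 ≤ (Xᵀ * M * X).trace :=
  (PosSemidef.congr hM X).trace_nonneg

/-- The congruence is positive semidefinite with trace zero, hence zero; its diagonal entries `xᵀ M
x`, for the columns `x` of `X`, then force `M x = 0`. Equality cases of the energy estimates are
exploited in this way. -/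
theorem PosSemidef.mul_eq_zero_of_trace {p q : ℕ} {M : Matrix (Fin p) (Fin p) ℝ}
    (hM : M.PosSemidef) {X : Matrix (Fin p) (Fin q) ℝ} (h : (Xᵀ * M * X).trace = 0) :
    M * X = 0 := by
  have h0 := (PosSemidef.congr hM X).trace_eq_zero_iff.1 h
  have hc : ∀ j, M *ᵥ (fun i => X i j) = 0 := by
    intro j
    rw [← hM.dotProduct_mulVec_zero_iff]
    have := congrFun (congrFun h0 j) j
    rw [Matrix.mul_assoc] at this
    simpa [Matrix.mul_apply, Matrix.mulVec, dotProduct] using this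
  ext i j
  simpa [Matrix.mul_apply, Matrix.mulVec, dotProduct] using congrFun (hc j) i

theorem posSemidef_transpose_mul_self {p q : ℕ} (X : Matrix (Fin p) (Fin q) ℝ) :
    (Xᵀ * X).PosSemidef := by
  simpa using Matrix.posSemidef_conjTranspose_mul_self X

theorem posSemidef_mul_transpose_self {p q : ℕ} (X : Matrix (Fin p) (Fin q) ℝ) :
    (X * Xᵀ).PosSemidef := by
  simpa using Matrix.posSemidef_self_mul_conjTranspose X

/-- The rotation part of `cplx σ ω` is skew and drops out against a symmetric matrix. -/
theorem trace_mul_cplx {Y : Matrix (Fin 2) (Fin 2) ℝ} (hY : Yᵀ = Y) (σ ω : ℝ) :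
    (Y * cplx σ ω).trace = σ * Y.trace := by
  have h : Y 1 0 = Y 0 1 := congrFun (congrFun hY 0) 1
  simp [Matrix.trace, Matrix.mul_apply, cplx, h]
  ring

/-- The energy identity: along `F X = X Λ + Z`, where `Λ` acts as `σ + i ω`. -/
theorem trace_energy {p : ℕ} {F P : Matrix (Fin p) (Fin p) ℝ} (hP : Pᵀ = P)
    {X Z : Matrix (Fin p) (Fin 2) ℝ} {σ ω : ℝ} (h : F * X = X * cplx σ ω + Z) :
    (Xᵀ * (Fᵀ * P + P * F) * X).trace
      = 2 * (σ * (Xᵀ * P * X).trace + (Xᵀ * P * Z).trace) := by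
  have hs : (Xᵀ * P * X)ᵀ = Xᵀ * P * X := by simp [hP, Matrix.mul_assoc]
  have h1 : (Xᵀ * P * (F * X)).trace = σ * (Xᵀ * P * X).trace + (Xᵀ * P * Z).trace := by
    rw [h, Matrix.mul_add, Matrix.trace_add, ← Matrix.mul_assoc, trace_mul_cplx hs]
  have h2 : (Xᵀ * Fᵀ * P * X).trace = (Xᵀ * P * (F * X)).trace := by
    rw [← Matrix.trace_transpose]
    simp [hP, Matrix.mul_assoc]
  rw [Matrix.mul_add, Matrix.add_mul, Matrix.trace_add, two_mul, ← h1]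
  congr 1
  · rw [← h2, Matrix.mul_assoc Xᵀ Fᵀ P]
  · simp only [Matrix.mul_assoc]

theorem frobSq_sub {p q : ℕ} (X Y : Matrix (Fin p) (Fin q) ℝ) :
    frobSq (X - Y) = frobSq X - 2 * (Xᵀ * Y).trace + frobSq Y := by
  simp only [frobSq_eq_trace, Matrix.transpose_sub, Matrix.sub_mul, Matrix.mul_sub,
    Matrix.trace_sub, trace_transpose_mul_comm Y X]
  ring

/-! ### Limits of Hurwitz matrices and Lyapunov equations -/

open Filter Topology

theorem continuous_toC {p q : ℕ} :
    Continuous (toC : Matrix (Fin p) (Fin q) ℝ → Matrix (Fin p) (Fin q) ℂ) :=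
  continuous_id.matrix_map Complex.continuous_ofReal

/-- The determinant is the product of the factors `z - λ` over the eigenvalues, each of modulus at
least `Re z`. The bound does not depend on `F`, so it survives limits. -/
theorem IsHurwitz.re_pow_le_norm_det {p : ℕ} {F : Matrix (Fin p) (Fin p) ℝ} (hF : IsHurwitz F)
    {z : ℂ} (hz : 0 ≤ z.re) : z.re ^ p ≤ ‖(Matrix.scalar (Fin p) z - toC F).det‖ := by
  have hs := IsAlgClosed.splits (toC F).charpoly
  rw [← Matrix.eval_charpoly, hs.eval_eq_prod_roots_of_monic (Matrix.charpoly_monic _)]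
  have hc : (toC F).charpoly.roots.card = p := by
    rw [← hs.natDegree_eq_card_roots, Matrix.charpoly_natDegree_eq_dim, Fintype.card_fin]
  have hr : ∀ w ∈ (toC F).charpoly.roots, w.re < 0 := fun w hw =>
    hF w (Matrix.mem_spectrum_iff_isRoot_charpoly.2 (Polynomial.isRoot_of_mem_roots hw))
  have key : ∀ s : Multiset ℂ, (∀ w ∈ s, w.re < 0) →
      z.re ^ s.card ≤ ‖(s.map fun w => z - w).prod‖ := by
    intro s
    induction s using Multiset.induction_on with
    | empty => simp
    | cons w s ih =>
      intro h
      rw [Multiset.card_cons, pow_succ', Multiset.map_cons, Multiset.prod_cons, norm_mul]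
      have h1 : z.re ≤ ‖z - w‖ := by
        have := Complex.re_le_norm (z - w)
        have := h w (Multiset.mem_cons_self w s)
        simp only [Complex.sub_re] at *
        linarith
      exact mul_le_mul h1 (ih fun v hv => h v (Multiset.mem_cons_of_mem hv)) (by positivity)
        (norm_nonneg _)
  simpa [hc] using key _ hr

/-- A limit of Hurwitz matrices has no eigenvalue with positive real part. -/
theorem eq_zero_of_tendsto_isHurwitz {p : ℕ} {F : ℕ → Matrix (Fin p) (Fin p) ℝ}
    {F' : Matrix (Fin p) (Fin p) ℝ} (hF : ∀ j, IsHurwitz (F j)) (hl : Tendsto F atTop (𝓝 F'))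
    {σ ω : ℝ} (hσ : 0 < σ) {X : Matrix (Fin p) (Fin 2) ℝ} (hX : F' * X = X * cplx σ ω) :
    X = 0 := by
  by_contra h0
  have hz : (⟨σ, ω⟩ : ℂ) ∈ spectrum ℂ (toC F') := mem_spectrum_toC_iff.2 ⟨X, h0, hX⟩
  rw [spectrum.mem_iff, Matrix.isUnit_iff_isUnit_det, isUnit_iff_ne_zero, not_not] at hz
  have hc : Continuous fun M : Matrix (Fin p) (Fin p) ℝ =>
      ‖(Matrix.scalar (Fin p) (⟨σ, ω⟩ : ℂ) - toC M).det‖ :=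
    ((continuous_const.sub continuous_toC).matrix_det).norm
  have ht := (hc.tendsto F').comp hl
  have hle := ge_of_tendsto' ht fun j => (hF j).re_pow_le_norm_det (z := ⟨σ, ω⟩) hσ.le
  have hz' : (Matrix.scalar (Fin p) (⟨σ, ω⟩ : ℂ) - toC F').det = 0 := hz
  rw [hz', norm_zero] at hle
  exact absurd hle (not_le.2 (pow_pos hσ p))

/-- A limit of Hurwitz matrices without imaginary eigenvalues is Hurwitz. -/
theorem isHurwitz_of_tendsto {p : ℕ} {F : ℕ → Matrix (Fin p) (Fin p) ℝ}
    {F' : Matrix (Fin p) (Fin p) ℝ} (hF : ∀ j, IsHurwitz (F j)) (hl : Tendsto F atTop (𝓝 F'))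
    (hi : ∀ (ω : ℝ) (X : Matrix (Fin p) (Fin 2) ℝ), F' * X = X * cplx 0 ω → X = 0) :
    IsHurwitz F' := by
  rw [isHurwitz_iff]
  intro σ ω X hX hσ
  rcases hσ.eq_or_lt with rfl | hσ
  · exact hi ω X hX
  · exact eq_zero_of_tendsto_isHurwitz hF hl hσ hX

open scoped Matrix.Norms.L2Operator in
theorem isOpen_isHurwitz (p : ℕ) : IsOpen {F : Matrix (Fin p) (Fin p) ℝ | IsHurwitz F} := by
  have ho : IsOpen {z : ℂ | z.re < 0} := isOpen_lt Complex.continuous_re continuous_const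
  have h := (upperHemicontinuous_iff_isOpen_preimage_Iic).1
    (upperHemicontinuous_spectrum ℂ (Matrix (Fin p) (Fin p) ℂ)) _ ho
  exact h.preimage continuous_toC

open scoped Matrix.Norms.L2Operator in
/-- The powers of a complex matrix with spectrum in the open unit disc tend to zero. -/
theorem tendsto_pow_zero_of_spectrum {p : ℕ} {M : Matrix (Fin p) (Fin p) ℂ}
    (hM : ∀ z ∈ spectrum ℂ M, ‖z‖ < 1) : Tendsto (fun k => M ^ k) atTop (𝓝 0) := by
  rcases Nat.eq_zero_or_pos p with rfl | hp
  · exact tendsto_const_nhds.congr fun k => Subsingleton.elim _ _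
  have : Nonempty (Fin p) := ⟨⟨0, hp⟩⟩
  have hr : spectralRadius ℂ M < ((1 : NNReal) : ENNReal) :=
    spectrum.spectralRadius_lt_of_forall_lt M fun z hz => by exact_mod_cast hM z hz
  obtain ⟨r, hr1, hr2⟩ := exists_between hr
  -- Gelfand's formula: the `k`-th root of `‖M ^ k‖` is eventually below some `r < 1`.
  have hev := (spectrum.pow_norm_pow_one_div_tendsto_nhds_spectralRadius M).eventually
    (gt_mem_nhds hr1)
  have hrt : r ≠ ⊤ := (hr2.trans_le le_top).ne
  have hr1' : r.toReal < 1 := by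
    have := (ENNReal.toReal_lt_toReal hrt ENNReal.coe_ne_top).2 hr2
    simpa using this
  refine squeeze_zero_norm' (a := fun k => r.toReal ^ k) ?_
    (tendsto_pow_atTop_nhds_zero_of_lt_one ENNReal.toReal_nonneg hr1')
  filter_upwards [hev, eventually_gt_atTop 0] with k hk hk0
  have h1 : ‖M ^ k‖ ^ (1 / k : ℝ) ≤ r.toReal :=
    (ENNReal.ofReal_le_iff_le_toReal hrt).1 hk.le
  have hk' : (k : ℝ) ≠ 0 := by positivity
  calc ‖M ^ k‖ = (‖M ^ k‖ ^ (1 / k : ℝ)) ^ k := by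
        rw [← Real.rpow_natCast, ← Real.rpow_mul (norm_nonneg _), one_div_mul_cancel hk',
          Real.rpow_one]
    _ ≤ r.toReal ^ k := pow_le_pow_left₀ (by positivity) h1 k

theorem IsHurwitz.isUnit_one_sub {p : ℕ} {F : Matrix (Fin p) (Fin p) ℝ} (hF : IsHurwitz F) :
    IsUnit (1 - F) := by
  rw [Matrix.isUnit_iff_isUnit_det, isUnit_iff_ne_zero]
  intro h0
  obtain ⟨v, hv, h⟩ := Matrix.exists_mulVec_eq_zero_iff.2 h0
  refine hv ?_
  have hX := isHurwitz_iff.1 hF 1 0 (Matrix.of fun i => ![v i, 0]) ?_ zero_le_one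
  · ext i
    simpa using congrFun (congrFun hX i) 0
  · rw [Matrix.sub_mulVec, Matrix.one_mulVec, sub_eq_zero] at h
    ext i j
    have hi := congrFun h i
    simp only [Matrix.mulVec, dotProduct] at hi
    fin_cases j
    · simp [Matrix.mul_apply, cplx, hi]
    · simp [Matrix.mul_apply, cplx]

theorem toC_one {p : ℕ} : toC (1 : Matrix (Fin p) (Fin p) ℝ) = 1 :=
  Matrix.map_one _ Complex.ofReal_zero Complex.ofReal_one

theorem toC_add {p q : ℕ} (M N : Matrix (Fin p) (Fin q) ℝ) : toC (M + N) = toC M + toC N := by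
  ext; simp [toC]

theorem toC_sub {p q : ℕ} (M N : Matrix (Fin p) (Fin q) ℝ) : toC (M - N) = toC M - toC N := by
  ext; simp [toC]

theorem toC_pow {p : ℕ} (M : Matrix (Fin p) (Fin p) ℝ) (k : ℕ) : toC (M ^ k) = toC M ^ k := by
  induction k with
  | zero => simp [toC_one]
  | succ k ih => rw [pow_succ, toC_mul, ih, pow_succ]

/-- The Cayley transform of a Hurwitz matrix has powers tending to zero. -/
theorem IsHurwitz.tendsto_cayley_pow {p : ℕ} {F N : Matrix (Fin p) (Fin p) ℝ} (hF : IsHurwitz F)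
    (hN : (1 - F) * N = 1) : Tendsto (fun k => ((1 + F) * N) ^ k) atTop (𝓝 0) := by
  have hz : ∀ z ∈ spectrum ℂ (toC ((1 + F) * N)), ‖z‖ < 1 := by
    intro z hz
    obtain ⟨v, hv, h⟩ := mem_spectrum_iff_mulVec.1 hz
    set y := toC N *ᵥ v with hy
    have hvy : v = y - toC F *ᵥ y := by
      rw [hy, Matrix.mulVec_mulVec, ← toC_mul, ← Matrix.sub_mulVec, ← toC_sub]
      have : N - F * N = 1 := by rw [← hN]; noncomm_ring
      rw [this, toC_one, Matrix.one_mulVec]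
    have hzy : y + toC F *ᵥ y = z • v := by
      rw [← h, toC_mul, ← Matrix.mulVec_mulVec, ← hy, toC_add, toC_one, Matrix.add_mulVec,
        Matrix.one_mulVec]
    rw [hvy] at hzy
    have hy0 : y ≠ 0 := by
      intro h0
      exact hv (by rw [hvy, h0, Matrix.mulVec_zero, sub_zero])
    -- An eigenvalue `z` of the Cayley transform comes from the eigenvalue `(z - 1) / (z + 1)` of
    -- `F`, whose real part has the sign of `|z|² - 1`.
    have e1 : (1 + z) • (toC F *ᵥ y) = (z - 1) • y := by
      rw [smul_sub] at hzy
      rw [add_smul, sub_smul, one_smul, one_smul]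
      have := congrArg (fun t => t + z • (toC F *ᵥ y) - y) hzy
      rw [show y + toC F *ᵥ y + z • (toC F *ᵥ y) - y = toC F *ᵥ y + z • (toC F *ᵥ y) by abel,
        show z • y - z • (toC F *ᵥ y) + z • (toC F *ᵥ y) - y = z • y - y by abel] at this
      exact this
    have hz1 : 1 + z ≠ 0 := by
      intro h0
      rw [h0, zero_smul] at e1
      have : z - 1 = 0 := (smul_eq_zero.1 e1.symm).resolve_right hy0
      have h2 : (2 : ℂ) = 0 := by linear_combination h0 - this
      exact two_ne_zero h2
    have e2 : toC F *ᵥ y = ((z - 1) / (1 + z)) • y := by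
      rw [div_eq_inv_mul, mul_smul, ← e1, smul_smul, inv_mul_cancel₀ hz1, one_smul]
    have hre := hF _ (mem_spectrum_iff_mulVec.2 ⟨y, hy0, e2⟩)
    have hn : 0 < Complex.normSq (1 + z) := Complex.normSq_pos.2 hz1
    rw [Complex.div_re, ← add_div, div_lt_iff₀ hn, zero_mul] at hre
    simp at hre
    rw [← sq_lt_one_iff₀ (norm_nonneg _), Complex.sq_norm, Complex.normSq_apply]
    nlinarith
  have h := tendsto_pow_zero_of_spectrum hz
  have hre : Continuous fun M : Matrix (Fin p) (Fin p) ℂ => M.map Complex.re :=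
    continuous_id.matrix_map Complex.continuous_re
  have h2 := (hre.tendsto 0).comp h
  rw [Matrix.map_zero _ Complex.zero_re] at h2
  refine h2.congr fun k => ?_
  rw [Function.comp_apply, ← toC_pow]
  ext i j
  simp [toC]

/-- Lyapunov's theorem. -/
theorem IsHurwitz.posSemidef_of_lyapunov {p : ℕ} {F P Q : Matrix (Fin p) (Fin p) ℝ}
    (hF : IsHurwitz F) (hP : Pᵀ = P) (hQ : Q.PosSemidef) (h : Fᵀ * P + P * F + Q = 0) :
    P.PosSemidef := by
  obtain ⟨u, hu⟩ := hF.isUnit_one_sub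
  set N : Matrix (Fin p) (Fin p) ℝ := ↑u⁻¹ with hNdef
  have hN : (1 - F) * N = 1 := by rw [← hu, hNdef]; simp
  set M := (1 + F) * N with hM
  have hNt : Nᵀ * (1 - Fᵀ) = 1 := by
    have := congrArg Matrix.transpose hN
    simpa using this
  -- The Cayley transform turns the Lyapunov equation into a Stein equation. Iterating it gives `P ≥
  -- (M ^ k)ᵀ P M ^ k`, and the right side tends to zero.
  have hstein : P = Mᵀ * P * M + (2 : ℝ) • (Nᵀ * Q * N) := by
    have hQ' : Q = -(Fᵀ * P + P * F) := by rw [← sub_eq_zero, sub_neg_eq_add, add_comm, h]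
    have e : (1 - Fᵀ) * P * (1 - F) = (1 + Fᵀ) * P * (1 + F) + (2 : ℝ) • Q := by
      rw [hQ', two_smul]
      noncomm_ring
    calc P = (Nᵀ * (1 - Fᵀ)) * P * ((1 - F) * N) := by rw [hN, hNt, one_mul, mul_one]
      _ = Nᵀ * ((1 - Fᵀ) * P * (1 - F)) * N := by noncomm_ring
      _ = _ := by
        rw [e, hM, Matrix.transpose_mul, Matrix.transpose_add, Matrix.transpose_one,
          Matrix.mul_add, Matrix.add_mul, Matrix.mul_smul, Matrix.smul_mul]
        congr 1
        noncomm_ring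
  have hit : ∀ k, (P - (M ^ k)ᵀ * P * M ^ k).PosSemidef := by
    intro k
    induction k with
    | zero => simpa using Matrix.PosSemidef.zero
    | succ k ih =>
      have e : P - (M ^ (k + 1))ᵀ * P * M ^ (k + 1)
          = (2 : ℝ) • (Nᵀ * Q * N) + Mᵀ * (P - (M ^ k)ᵀ * P * M ^ k) * M := by
        rw [pow_succ, Matrix.transpose_mul]
        nth_rewrite 1 [hstein]
        noncomm_ring
      rw [e]
      exact ((PosSemidef.congr hQ N).smul zero_le_two).add (PosSemidef.congr ih M)
  have hlim : Tendsto (fun k => P - (M ^ k)ᵀ * P * M ^ k) atTop (𝓝 P) := by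
    have hc : Continuous fun Z : Matrix (Fin p) (Fin p) ℝ => P - Zᵀ * P * Z := by fun_prop
    have := (hc.tendsto 0).comp (hF.tendsto_cayley_pow hN)
    rwa [Matrix.mul_zero, sub_zero] at this
  refine Matrix.PosSemidef.of_dotProduct_mulVec_nonneg (by simpa [Matrix.IsHermitian] using hP)
    fun x => ?_
  have hc : Continuous fun Z : Matrix (Fin p) (Fin p) ℝ => star x ⬝ᵥ Z *ᵥ x := by fun_prop
  exact ge_of_tendsto' ((hc.tendsto P).comp hlim) fun k => (hit k).dotProduct_mulVec_nonneg x

/-- Solvability of the Sylvester equation `Fᵀ X + X F' = - Q` for Hurwitz `F` and `F'`. -/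
theorem exists_sylvester {p : ℕ} {F F' : Matrix (Fin p) (Fin p) ℝ} (hF : IsHurwitz F)
    (hF' : IsHurwitz F') (Q : Matrix (Fin p) (Fin p) ℝ) :
    ∃ P, Fᵀ * P + P * F' + Q = 0 := by
  let L : Matrix (Fin p) (Fin p) ℝ →ₗ[ℝ] Matrix (Fin p) (Fin p) ℝ :=
    LinearMap.mulLeft ℝ Fᵀ + LinearMap.mulRight ℝ F'
  have hi : Function.Injective L := by
    rw [injective_iff_map_eq_zero]
    intro X hX
    exact sylvester_zero hF hF' hX
  obtain ⟨P, hP⟩ := LinearMap.injective_iff_surjective.1 hi (-Q)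
  refine ⟨P, ?_⟩
  have hP' : Fᵀ * P + P * F' = -Q := hP
  rw [hP', neg_add_cancel]

theorem IsHurwitz.exists_lyapunov {p : ℕ} {F Q : Matrix (Fin p) (Fin p) ℝ} (hF : IsHurwitz F)
    (hQ : Q.PosSemidef) : ∃ P : Matrix (Fin p) (Fin p) ℝ, P.PosSemidef ∧
      Fᵀ * P + P * F + Q = 0 := by
  obtain ⟨P, hP⟩ := exists_sylvester hF hF Q
  have ht : Fᵀ * Pᵀ + Pᵀ * F + Q = 0 := by
    have := congrArg Matrix.transpose hP
    simp only [Matrix.transpose_add, Matrix.transpose_mul, Matrix.transpose_transpose,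
      PosSemidef.transpose_eq hQ, Matrix.transpose_zero] at this
    rwa [add_comm (Fᵀ * Pᵀ)]
  -- The transpose solves the same equation, so uniqueness gives symmetry.
  have hs : Pᵀ = P := by
    refine sub_eq_zero.1 (sylvester_zero hF hF ?_)
    rw [← sub_eq_zero.2 (ht.trans hP.symm)]
    noncomm_ring
  exact ⟨P, hF.posSemidef_of_lyapunov hs hQ hP, hP⟩

/-! ### Frobenius norm estimates and compactness -/

section Frobenius

open scoped Matrix.Norms.Frobenius

theorem frobSq_eq_norm_sq {p q : ℕ} (X : Matrix (Fin p) (Fin q) ℝ) : frobSq X = ‖X‖ ^ 2 := by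
  rw [Matrix.frobenius_norm_def, ← Real.sqrt_eq_rpow, Real.sq_sqrt]
  · simp [frobSq]
  · positivity

theorem frobSq_mul_le {p q r : ℕ} (X : Matrix (Fin p) (Fin q) ℝ) (Y : Matrix (Fin q) (Fin r) ℝ) :
    frobSq (X * Y) ≤ frobSq X * frobSq Y := by
  simp only [frobSq_eq_norm_sq, ← mul_pow]
  exact pow_le_pow_left₀ (norm_nonneg _) (Matrix.frobenius_norm_mul X Y) 2

theorem frobSq_add_le {p q : ℕ} (X Y : Matrix (Fin p) (Fin q) ℝ) :
    frobSq (X + Y) ≤ 2 * frobSq X + 2 * frobSq Y := by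
  simp only [frobSq_eq_norm_sq]
  have := norm_add_le X Y
  nlinarith [norm_nonneg (X + Y), sq_nonneg (‖X‖ - ‖Y‖), norm_nonneg X, norm_nonneg Y]

theorem frobSq_smul {p q : ℕ} (c : ℝ) (X : Matrix (Fin p) (Fin q) ℝ) :
    frobSq (c • X) = c ^ 2 * frobSq X := by
  simp [frobSq, mul_pow, Finset.mul_sum]

theorem exists_subseq_tendsto_of_frobSq_le {p q : ℕ} {X : ℕ → Matrix (Fin p) (Fin q) ℝ} {c : ℝ}
    (h : ∀ j, frobSq (X j) ≤ c) :
    ∃ (X' : Matrix (Fin p) (Fin q) ℝ) (φ : ℕ → ℕ), StrictMono φ ∧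
      Tendsto (X ∘ φ) atTop (𝓝 X') := by
  have : ProperSpace (Matrix (Fin p) (Fin q) ℝ) := FiniteDimensional.proper ℝ _
  obtain ⟨X', -, φ, hφ, hl⟩ := tendsto_subseq_of_bounded
    (Metric.isBounded_closedBall (x := (0 : Matrix (Fin p) (Fin q) ℝ)) (r := Real.sqrt c))
    (x := X) fun j => by
      rw [mem_closedBall_zero_iff]
      exact Real.le_sqrt_of_sq_le ((frobSq_eq_norm_sq _).symm.trans_le (h j))
  exact ⟨X', φ, hφ, hl⟩

theorem trace_mul_sq_le {p q : ℕ} (X : Matrix (Fin p) (Fin q) ℝ) (Y : Matrix (Fin q) (Fin p) ℝ) :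
    (X * Y).trace ^ 2 ≤ frobSq X * frobSq Y := by
  have h := Finset.sum_mul_sq_le_sq_mul_sq Finset.univ (fun a : Fin p × Fin q => X a.1 a.2)
    (fun a => Y a.2 a.1)
  simp only [Fintype.sum_prod_type] at h
  rw [frobSq, frobSq, Finset.sum_comm (f := fun i j => Y i j ^ 2)]
  simpa [Matrix.trace, Matrix.mul_apply] using h

end Frobenius

/-- With `M = Lᵀ L` the Frobenius norm of `M` is at most that of `L` squared, which is `tr M`.
Bounds on traces thus give compactness. -/
theorem PosSemidef.frobSq_le {p : ℕ} {M : Matrix (Fin p) (Fin p) ℝ} (hM : M.PosSemidef) :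
    frobSq M ≤ M.trace ^ 2 := by
  obtain ⟨L, hL⟩ : ∃ L : Matrix (Fin p) (Fin p) ℝ, M = Lᵀ * L := by
    open scoped MatrixOrder Matrix.Norms.L2Operator in
    obtain ⟨L, hL⟩ := CStarAlgebra.nonneg_iff_eq_star_mul_self.mp hM.nonneg
    exact ⟨L, by simpa [Matrix.star_eq_conjTranspose] using hL⟩
  have h := frobSq_mul_le Lᵀ L
  have ht : frobSq Lᵀ = frobSq L := by
    rw [frobSq, frobSq, Finset.sum_comm]
    simp
  rw [ht, ← sq, frobSq_eq_trace L, ← hL] at h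
  exact h

theorem PosDef.exists_lower_bound {p : ℕ} {M : Matrix (Fin p) (Fin p) ℝ} (hM : M.PosDef) :
    ∃ c : ℝ, 0 < c ∧ (M - c • (1 : Matrix (Fin p) (Fin p) ℝ)).PosSemidef := by
  open scoped MatrixOrder Matrix.Norms.L2Operator in
  rcases Nat.eq_zero_or_pos p with rfl | hp
  · exact ⟨1, one_pos, by rw [Subsingleton.elim (M - _) 0]; exact Matrix.PosSemidef.zero⟩
  have : Nonempty (Fin p) := ⟨⟨0, hp⟩⟩
  obtain ⟨c, hc, h⟩ := (CFC.exists_pos_algebraMap_le_iff (a := M) hM.isHermitian).2 fun x hx => by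
    rw [hM.isHermitian.spectrum_real_eq_range_eigenvalues] at hx
    obtain ⟨i, rfl⟩ := hx
    exact hM.eigenvalues_pos i
  refine ⟨c, hc, ?_⟩
  rw [Matrix.le_iff, Algebra.algebraMap_eq_smul_one] at h
  exact h

theorem isClosed_posSemidef (p : ℕ) :
    IsClosed {M : Matrix (Fin p) (Fin p) ℝ | M.PosSemidef} := by
  have : {M : Matrix (Fin p) (Fin p) ℝ | M.PosSemidef}
      = {M | Mᵀ = M} ∩ ⋂ x : Fin p → ℝ, {M | 0 ≤ star x ⬝ᵥ M *ᵥ x} := by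
    ext M
    simp [Matrix.posSemidef_iff_dotProduct_mulVec, Matrix.IsHermitian]
  rw [this]
  refine (isClosed_eq (by fun_prop) continuous_id).inter (isClosed_iInter fun x => ?_)
  exact isClosed_le continuous_const (by fun_prop)

/-! ### The strict bounded real lemma: existence of the stabilizing solution -/

/-- The response `X` of `F X + G W = i ω X` satisfies `tr (Xᵀ Q X) ≤ θ ‖W‖²` at all
frequencies `ω`. -/
def FreqBound {p q : ℕ} (F : Matrix (Fin p) (Fin p) ℝ) (G : Matrix (Fin p) (Fin q) ℝ)
    (Q : Matrix (Fin p) (Fin p) ℝ) (θ : ℝ) : Prop :=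
  ∀ (ω : ℝ) (X : Matrix (Fin p) (Fin 2) ℝ) (W : Matrix (Fin q) (Fin 2) ℝ),
    F * X + G * W = X * cplx 0 ω → (Xᵀ * Q * X).trace ≤ θ * frobSq W

theorem IsHurwitz.exists_freqBound_one {p q : ℕ} {F : Matrix (Fin p) (Fin p) ℝ}
    (hF : IsHurwitz F) (G : Matrix (Fin p) (Fin q) ℝ) : ∃ c, 0 ≤ c ∧ FreqBound F G 1 c := by
  obtain ⟨Y, hY, hYe⟩ := hF.exists_lyapunov (Matrix.PosSemidef.one (n := Fin p) (R := ℝ))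
  -- Energy with `Fᵀ Y + Y F = -1` gives `‖X‖² = 2 tr (Xᵀ Y G W)`, and then `0 ≤ ‖X - 2 Y G W‖²`
  -- reads `‖X‖² ≤ 4 ‖Y G W‖²`.
  refine ⟨4 * frobSq (Y * G), by have := frobSq_nonneg (Y * G); positivity, fun ω X W h => ?_⟩
  have he := trace_energy (PosSemidef.transpose_eq hY) (Z := -(G * W))
    (by rw [← sub_eq_add_neg]; exact eq_sub_of_add_eq h)
  rw [eq_neg_of_add_eq_zero_left hYe] at he
  simp only [Matrix.mul_neg, Matrix.mul_one, Matrix.neg_mul, Matrix.trace_neg, zero_mul,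
    zero_add] at he
  have h2 : (Xᵀ * Y * (G * W)).trace = (Xᵀ * (Y * G * W)).trace := by
    simp only [Matrix.mul_assoc]
  rw [h2, ← frobSq_eq_trace] at he
  have h3 := frobSq_sub X ((2 : ℝ) • (Y * G * W))
  rw [frobSq_smul, Matrix.mul_smul, Matrix.trace_smul, smul_eq_mul] at h3
  have h4 := frobSq_nonneg (X - (2 : ℝ) • (Y * G * W))
  have h5 := frobSq_mul_le (Y * G) W
  rw [Matrix.mul_one, ← frobSq_eq_trace]
  nlinarith

theorem FreqBound.add_smul_one {p q : ℕ} {F Q : Matrix (Fin p) (Fin p) ℝ}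
    {G : Matrix (Fin p) (Fin q) ℝ} {θ c ε : ℝ} (h : FreqBound F G Q θ) (h1 : FreqBound F G 1 c)
    (hε : 0 ≤ ε) : FreqBound F G (Q + ε • (1 : Matrix (Fin p) (Fin p) ℝ)) (θ + ε * c) := by
  intro ω X W hX
  have a := h ω X W hX
  have b := h1 ω X W hX
  simp only [Matrix.mul_add, Matrix.add_mul, Matrix.trace_add, Matrix.mul_smul, Matrix.smul_mul,
    Matrix.trace_smul, smul_eq_mul]
  nlinarith [mul_le_mul_of_nonneg_left b hε]

/-- Stabilizing solutions of the Riccati equation `Fᵀ P + P F + Q + P S P = 0`. -/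
def StabRicc {p : ℕ} (F S Q P : Matrix (Fin p) (Fin p) ℝ) : Prop :=
  P.PosSemidef ∧ Fᵀ * P + P * F + Q + P * S * P = 0 ∧ IsHurwitz (F + S * P)

/-- Under the strict frequency bound, no solution of the Riccati equation has closed-loop
eigenvalues on the imaginary axis. -/
theorem FreqBound.eq_zero_of_riccati {p q : ℕ} {F Q P : Matrix (Fin p) (Fin p) ℝ}
    {G : Matrix (Fin p) (Fin q) ℝ} {θ t : ℝ} (hF : IsHurwitz F) (h : FreqBound F G Q θ)
    (hθ : θ < 1) (ht0 : 0 ≤ t) (ht1 : t ≤ 1) (hP : Pᵀ = P)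
    (hR : Fᵀ * P + P * F + Q + P * (t • (G * Gᵀ)) * P = 0) {ω : ℝ}
    {X : Matrix (Fin p) (Fin 2) ℝ} (hX : (F + t • (G * Gᵀ) * P) * X = X * cplx 0 ω) : X = 0 := by
  set V := Gᵀ * P * X with hV
  have hVt : Vᵀ = Xᵀ * P * G := by simp [hV, hP, Matrix.mul_assoc]
  have hGW : F * X + G * (t • V) = X * cplx 0 ω := by
    rw [← hX, hV, Matrix.add_mul]
    simp only [Matrix.mul_smul, Matrix.smul_mul, Matrix.mul_assoc]
  have he := trace_energy hP (Z := -(G * (t • V)))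
    (by rw [← sub_eq_add_neg]; exact eq_sub_of_add_eq hGW)
  have hq : Fᵀ * P + P * F = -(Q + P * (t • (G * Gᵀ)) * P) := by
    rw [← sub_eq_zero, sub_neg_eq_add, ← hR, ← add_assoc]
  have e1 : (Xᵀ * P * (-(G * (t • V)))).trace = -(t * frobSq V) := by
    rw [frobSq_eq_trace, hVt]
    simp only [Matrix.mul_neg, Matrix.trace_neg, Matrix.mul_smul, Matrix.trace_smul, smul_eq_mul,
      Matrix.mul_assoc]
  have e2 : (Xᵀ * (P * (t • (G * Gᵀ)) * P) * X).trace = t * frobSq V := by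
    rw [frobSq_eq_trace, hVt, hV]
    simp only [Matrix.mul_smul, Matrix.smul_mul, Matrix.trace_smul, smul_eq_mul, Matrix.mul_assoc]
  rw [hq, e1, Matrix.mul_neg, Matrix.neg_mul, Matrix.trace_neg, Matrix.mul_add, Matrix.add_mul,
    Matrix.trace_add, e2] at he
  -- The closed-loop mode `X` is the response of `F` to the disturbance `t V`. The energy identity
  -- says `tr (Xᵀ Q X) = t ‖V‖²`, whereas the frequency bound allows only `θ t² ‖V‖²`. As `θ t < 1`,
  -- `t V = 0`, and `i ω` would be an eigenvalue of `F` itself.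
  have hb := h ω X (t • V) hGW
  rw [frobSq_smul] at hb
  have hv := frobSq_nonneg V
  have hle : t * frobSq V * (1 - θ * t) ≤ 0 := by nlinarith
  have hpos : 0 < 1 - θ * t := by
    rcases le_total 0 θ with h0 | h0 <;> nlinarith
  have hz : t * frobSq V = 0 :=
    le_antisymm (nonpos_of_mul_nonpos_left hle hpos) (mul_nonneg ht0 hv)
  have htV : t • V = 0 := by
    rcases mul_eq_zero.1 hz with h0 | h0
    · rw [h0, zero_smul]
    · rw [frobSq_eq_zero_iff.1 h0, smul_zero]
  rw [htV, Matrix.mul_zero, add_zero] at hGW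
  exact isHurwitz_iff.1 hF 0 ω X hGW le_rfl

/-- Limits of stabilizing solutions are stabilizing under the strict frequency bound. -/
theorem StabRicc.of_tendsto {p q : ℕ} {F Q P : Matrix (Fin p) (Fin p) ℝ}
    {G : Matrix (Fin p) (Fin q) ℝ} {θ t : ℝ} (hF : IsHurwitz F) (h : FreqBound F G Q θ)
    (hθ : θ < 1) (ht0 : 0 ≤ t) (ht1 : t ≤ 1) {tj : ℕ → ℝ} {Qj Pj : ℕ → Matrix (Fin p) (Fin p) ℝ}
    (hj : ∀ j, StabRicc F (tj j • (G * Gᵀ)) (Qj j) (Pj j)) (htj : Tendsto tj atTop (𝓝 t))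
    (hQj : Tendsto Qj atTop (𝓝 Q)) (hPj : Tendsto Pj atTop (𝓝 P)) :
    StabRicc F (t • (G * Gᵀ)) Q P := by
  have hP : P.PosSemidef :=
    (isClosed_posSemidef p).mem_of_tendsto hPj (Eventually.of_forall fun j => (hj j).1)
  have hS : Tendsto (fun j => tj j • (G * Gᵀ)) atTop (𝓝 (t • (G * Gᵀ))) := htj.smul_const _
  have hR : Fᵀ * P + P * F + Q + P * (t • (G * Gᵀ)) * P = 0 := by
    refine tendsto_nhds_unique ?_ (tendsto_const_nhds (f := atTop (α := ℕ)))
    refine Tendsto.congr (fun j => (hj j).2.1) ?_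
    exact (((hPj.const_mul _).add (hPj.mul_const _)).add hQj).add ((hPj.mul hS).mul hPj)
  refine ⟨hP, hR, isHurwitz_of_tendsto (fun j => (hj j).2.2)
    (tendsto_const_nhds.add (hS.mul hPj)) fun ω X hX => ?_⟩
  exact h.eq_zero_of_riccati hF hθ ht0 ht1 (PosSemidef.transpose_eq hP) hR hX

/-- Expanding the quadratic term around `P` absorbs the part linear in `P' - P` into the closed loop
of `P`; what remains is a Lyapunov equation. -/
theorem riccati_sub {p : ℕ} {F S Q P P' M : Matrix (Fin p) (Fin p) ℝ} (hS : Sᵀ = S) (hP : Pᵀ = P)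
    (h : Fᵀ * P + P * F + Q + P * S * P = 0)
    (h' : Fᵀ * P' + P' * F + Q + P' * S * P' + M = 0) :
    (F + S * P)ᵀ * (P' - P) + (P' - P) * (F + S * P)
      + ((P' - P) * S * (P' - P) + M) = 0 := by
  rw [← sub_eq_zero.2 (h'.trans h.symm), Matrix.transpose_add, Matrix.transpose_mul, hS, hP]
  noncomm_ring

/-- Comparison principle: the stabilizing solution lies below every symmetric solution with residual
`M ≥ 0`, since the difference solves a Lyapunov equation for a Hurwitz closed loop. -/
theorem sub_posSemidef_of_riccati {p : ℕ} {F S Q P P' M : Matrix (Fin p) (Fin p) ℝ}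
    (hS : S.PosSemidef) (hP : StabRicc F S Q P) (hP' : P'ᵀ = P') (hM : M.PosSemidef)
    (h' : Fᵀ * P' + P' * F + Q + P' * S * P' + M = 0) : (P' - P).PosSemidef := by
  have hPt := PosSemidef.transpose_eq hP.1
  have hX : (P' - P)ᵀ = P' - P := by rw [Matrix.transpose_sub, hPt, hP']
  have hXS := PosSemidef.congr hS (P' - P)
  rw [hX] at hXS
  exact hP.2.2.posSemidef_of_lyapunov hX (hXS.add hM)
    (riccati_sub (PosSemidef.transpose_eq hS) hPt hP.2.1 h')

open scoped Matrix.Norms.L2Operator in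
/-- Stabilizing solutions persist under perturbation of the coefficient `t`. -/
theorem StabRicc.eventually {p : ℕ} {F S Q P : Matrix (Fin p) (Fin p) ℝ} {t : ℝ}
    (hS : Sᵀ = S) (hQ : Qᵀ = Q) (h : StabRicc F (t • S) Q P) :
    ∀ᶠ t' in 𝓝 t, ∃ P', P'ᵀ = P' ∧ Fᵀ * P' + P' * F + Q + P' * (t' • S) * P' = 0 ∧
      IsHurwitz (F + t' • S * P') := by
  obtain ⟨hP, hR, hH⟩ := h
  have hPt := PosSemidef.transpose_eq hP
  -- Keeping `t` as the first component lets a surjective derivative, hence local openness of `Φ` at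
  -- `(t, P)`, play the role of the implicit function theorem.
  let Φ : ℝ × Matrix (Fin p) (Fin p) ℝ → ℝ × Matrix (Fin p) (Fin p) ℝ := fun x =>
    (x.1, Fᵀ * x.2 + x.2 * F + x.1 • (x.2 * S * x.2))
  have h2 : HasStrictFDerivAt (fun x : ℝ × Matrix (Fin p) (Fin p) ℝ => x.2)
      (ContinuousLinearMap.snd ℝ ℝ (Matrix (Fin p) (Fin p) ℝ)) (t, P) := hasStrictFDerivAt_snd
  have h1 : HasStrictFDerivAt (fun x : ℝ × Matrix (Fin p) (Fin p) ℝ => x.1)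
      (ContinuousLinearMap.fst ℝ ℝ (Matrix (Fin p) (Fin p) ℝ)) (t, P) := hasStrictFDerivAt_fst
  have hΦ := h1.prodMk (((h2.const_mul Fᵀ).add (h2.mul_const' F)).add
    (h1.smul ((h2.mul_const' S).mul' h2)))
  have hmap := hΦ.map_nhds_eq_of_surj (by
    rw [LinearMap.range_eq_top]
    rintro ⟨s, Z⟩
    obtain ⟨Y, hY⟩ := exists_sylvester hH hH (s • (P * S * P) - Z)
    refine ⟨(s, Y), Prod.ext rfl ?_⟩
    have : Fᵀ * Y + Y * F + (t • (P * S * Y + Y * S * P) + s • (P * S * P)) = Z := by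
      rw [← sub_eq_zero, ← hY, Matrix.transpose_add, Matrix.transpose_mul, Matrix.transpose_smul,
        hS, hPt]
      simp only [Matrix.add_mul, Matrix.mul_add, Matrix.smul_mul, Matrix.mul_smul, smul_add,
        Matrix.mul_assoc]
      abel
    rw [← this]
    simp [MulOpposite.smul_eq_mul_unop])
  -- The nearby solution need not be symmetric a priori. Requiring the loop with its transpose to be
  -- Hurwitz too makes `P' - P'ᵀ` a solution of a Sylvester equation that has only the zero
  -- solution.
  have hopen : IsOpen {x : ℝ × Matrix (Fin p) (Fin p) ℝ |
      IsHurwitz (F + x.1 • S * x.2) ∧ IsHurwitz (F + x.1 • S * x.2ᵀ)} := by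
    refine ((isOpen_isHurwitz p).preimage ?_).inter ((isOpen_isHurwitz p).preimage ?_) <;>
    fun_prop
  have hU := hopen.mem_nhds (show (t, P) ∈ _ from ⟨hH, by simpa only [hPt] using hH⟩)
  have himg := image_mem_map (m := Φ) hU
  have hmap' : map Φ (𝓝 (t, P)) = 𝓝 (Φ (t, P)) := hmap
  have hval : Φ (t, P) = (t, -Q) := by
    refine Prod.ext rfl ?_
    rw [eq_neg_iff_add_eq_zero, ← hR]
    simp only [Φ, Matrix.mul_smul, Matrix.smul_mul]
    abel
  rw [hmap', hval] at himg
  have hc : Tendsto (fun t' : ℝ => (t', -Q)) (𝓝 t) (𝓝 (t, -Q)) :=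
    (continuous_id.prodMk continuous_const).tendsto t
  filter_upwards [hc.eventually himg] with t' ht'
  obtain ⟨⟨s, P'⟩, ⟨hH1, hH2⟩, he⟩ := ht'
  obtain ⟨rfl, he⟩ := Prod.ext_iff.1 he
  have hR' : Fᵀ * P' + P' * F + Q + P' * (s • S) * P' = 0 := by
    rw [← sub_eq_zero.2 he]
    simp only [Φ, Matrix.mul_smul, Matrix.smul_mul]
    abel
  refine ⟨P', ?_, hR', hH1⟩
  have hRt : Fᵀ * P'ᵀ + P'ᵀ * F + Q + P'ᵀ * (s • S) * P'ᵀ = 0 := by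
    have := congrArg Matrix.transpose hR'
    simp only [Matrix.transpose_add, Matrix.transpose_mul, Matrix.transpose_transpose, hQ, hS,
      Matrix.transpose_zero, Matrix.transpose_smul, ← Matrix.mul_assoc] at this
    rw [← this]
    abel
  refine (sub_eq_zero.1 (sylvester_zero hH2 hH2 ?_)).symm
  rw [← sub_eq_zero.2 (hR'.trans hRt.symm), Matrix.transpose_add, Matrix.transpose_mul,
    Matrix.transpose_transpose, Matrix.transpose_smul, hS]
  simp only [Matrix.add_mul, Matrix.mul_sub, Matrix.sub_mul, Matrix.mul_add, Matrix.smul_mul,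
    Matrix.mul_smul, Matrix.mul_assoc, smul_sub]
  abel

theorem IsHurwitz.transpose {p : ℕ} {F : Matrix (Fin p) (Fin p) ℝ} (hF : IsHurwitz F) :
    IsHurwitz Fᵀ := by
  intro z hz
  refine hF z ?_
  rw [Matrix.mem_spectrum_iff_isRoot_charpoly] at hz ⊢
  have : toC Fᵀ = (toC F)ᵀ := rfl
  rwa [this, Matrix.charpoly_transpose] at hz

/-- An invariant kernel contains an eigenvector. -/
theorem exists_eigenvector_of_ker_invariant {p : ℕ} {F X : Matrix (Fin p) (Fin p) ℝ}
    (hX : X.det = 0)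
    (hinv : ∀ V : Matrix (Fin p) (Fin 2) ℝ, X * V = 0 → X * (F * V) = 0) :
    ∃ (σ ω : ℝ) (V : Matrix (Fin p) (Fin 2) ℝ), V ≠ 0 ∧ X * V = 0 ∧ F * V = V * cplx σ ω := by
  let E : Submodule ℂ (Fin p → ℂ) := LinearMap.ker (toC X).mulVecLin
  have hmem : ∀ v, v ∈ E ↔ X * reIm v = 0 := by
    intro v
    rw [← reIm_mulVec, reIm_eq_zero_iff]
    exact LinearMap.mem_ker
  have hE : ∀ v ∈ E, (toC F).mulVecLin v ∈ E := by
    intro v hv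
    rw [hmem] at hv ⊢
    rw [Matrix.mulVecLin_apply, reIm_mulVec]
    exact hinv _ hv
  have hdet : (toC X).det = 0 := by
    have : (toC X).det = ((X.det : ℝ) : ℂ) := (RingHom.map_det Complex.ofRealHom X).symm
    rw [this, hX, Complex.ofReal_zero]
  obtain ⟨v, hv0, hv⟩ := Matrix.exists_mulVec_eq_zero_iff.2 hdet
  have : Nontrivial E := ⟨⟨⟨v, LinearMap.mem_ker.2 hv⟩, 0, fun h => hv0 (congrArg Subtype.val h)⟩⟩
  obtain ⟨z, hz⟩ := Module.End.exists_eigenvalue ((toC F).mulVecLin.restrict hE)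
  obtain ⟨w, hw⟩ := hz.exists_hasEigenvector
  have hw2 := congrArg Subtype.val hw.apply_eq_smul
  have hw3 : toC F *ᵥ (w : Fin p → ℂ) = z • (w : Fin p → ℂ) := hw2
  refine ⟨z.re, z.im, reIm (w : Fin p → ℂ), ?_, (hmem _).1 w.2, ?_⟩
  · rw [Ne, reIm_eq_zero_iff]
    exact fun h => hw.2 (Subtype.ext h)
  · rw [← reIm_mulVec, hw3, reIm_smul]

theorem tendsto_inv_of_det_ne_zero {p : ℕ} {X : ℕ → Matrix (Fin p) (Fin p) ℝ}
    {X' : Matrix (Fin p) (Fin p) ℝ} (h : Tendsto X atTop (𝓝 X')) (hd : X'.det ≠ 0) :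
    Tendsto (fun j => (X j)⁻¹) atTop (𝓝 X'⁻¹) := by
  have h1 : Continuous fun M : Matrix (Fin p) (Fin p) ℝ => M.det := continuous_id.matrix_det
  have h2 : Continuous fun M : Matrix (Fin p) (Fin p) ℝ => M.adjugate :=
    continuous_id.matrix_adjugate
  simp only [Matrix.inv_def, Ring.inverse_eq_inv']
  exact (((h1.tendsto X').comp h).inv₀ hd).smul ((h2.tendsto X').comp h)

/-- The hypothesis gives `tr M⁻¹ ≥ c ‖M⁻¹‖²`; insert this into `0 ≤ ‖1 - c M⁻¹‖² = p - 2 c tr M⁻¹ +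
c² ‖M⁻¹‖²`. -/
theorem frobSq_inv_le {p : ℕ} {M : Matrix (Fin p) (Fin p) ℝ} {c : ℝ} (hc : 0 < c)
    (hM : M.PosDef) (h : (M - c • (1 : Matrix (Fin p) (Fin p) ℝ)).PosSemidef) :
    frobSq M⁻¹ ≤ p / c ^ 2 := by
  have hu : M * M⁻¹ = 1 := Matrix.mul_nonsing_inv _ ((Matrix.isUnit_iff_isUnit_det _).1 hM.isUnit)
  have ht : (M⁻¹)ᵀ = M⁻¹ := PosSemidef.transpose_eq hM.inv.posSemidef
  have h1 := PosSemidef.trace_congr_nonneg h M⁻¹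
  have e1 : ((M⁻¹)ᵀ * (M - c • (1 : Matrix (Fin p) (Fin p) ℝ)) * M⁻¹).trace
      = M⁻¹.trace - c * frobSq M⁻¹ := by
    rw [Matrix.mul_sub, Matrix.sub_mul, Matrix.mul_assoc, hu, Matrix.mul_one, Matrix.mul_smul,
      Matrix.mul_one, Matrix.smul_mul, Matrix.trace_sub, Matrix.trace_smul, frobSq_eq_trace, ht,
      smul_eq_mul]
  rw [e1] at h1
  have h2 := frobSq_nonneg ((1 : Matrix (Fin p) (Fin p) ℝ) - c • M⁻¹)
  rw [frobSq_sub, frobSq_smul, Matrix.transpose_one, Matrix.one_mul, Matrix.trace_smul,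
    frobSq_eq_trace 1, Matrix.transpose_one, Matrix.one_mul, Matrix.trace_one, Fintype.card_fin,
    smul_eq_mul] at h2
  rw [le_div_iff₀ (by positivity)]
  nlinarith

theorem posDef_of_sub_posSemidef {p : ℕ} {M N : Matrix (Fin p) (Fin p) ℝ} (hN : N.PosDef)
    (h : (M - N).PosSemidef) : M.PosDef := by
  have := hN.add_posSemidef h
  rwa [add_sub_cancel] at this

/-- Solutions along the continuation have no evident upper bound, but their inverses are bounded;
hence the passage to the equation of the inverse. -/
theorem inv_riccati {p : ℕ} {F S Q P X : Matrix (Fin p) (Fin p) ℝ} (hPX : P * X = 1)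
    (h : Fᵀ * P + P * F + Q + P * S * P = 0) :
    X * Fᵀ + F * X + X * Q * X + S = 0 := by
  have hXP : X * P = 1 := mul_eq_one_comm.1 hPX
  have e : X * (Fᵀ * P + P * F + Q + P * S * P) * X
      = X * Fᵀ * (P * X) + (X * P) * F * X + X * Q * X + (X * P) * S * (P * X) := by
    noncomm_ring
  rw [h, hPX, hXP, Matrix.mul_zero, Matrix.zero_mul] at e
  simpa using e.symm

/-- The dual closed loop of a stabilizing solution with inverse `X` is antistable. -/
theorem StabRicc.isHurwitz_dual {p : ℕ} {F S Q P X : Matrix (Fin p) (Fin p) ℝ}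
    (hPX : P * X = 1) (h : StabRicc F S Q P) : IsHurwitz (-(Fᵀ + Q * X)) := by
  have hd := inv_riccati hPX h.2.1
  -- `X` intertwines the two loops, so they have the same eigenvalues.
  have e : X * -(Fᵀ + Q * X) = (F + S * P) * X := by
    rw [Matrix.add_mul, Matrix.mul_assoc S, hPX, Matrix.mul_one, ← sub_eq_zero, ← neg_eq_zero,
      ← hd]
    noncomm_ring
  rw [isHurwitz_iff]
  intro σ ω Z hZ hσ
  have hXZ : X * Z = 0 := by
    refine isHurwitz_iff.1 h.2.2 σ ω (X * Z) ?_ hσ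
    rw [← Matrix.mul_assoc, ← e, Matrix.mul_assoc X, hZ, Matrix.mul_assoc]
  rw [← Matrix.one_mul Z, ← hPX, Matrix.mul_assoc, hXZ, Matrix.mul_zero]

/-- Inverses of stabilizing solutions do not degenerate in the limit. -/
theorem det_ne_zero_of_tendsto {p : ℕ} {F S Q X : Matrix (Fin p) (Fin p) ℝ} {t : ℝ}
    {tj : ℕ → ℝ} {Pj Xj : ℕ → Matrix (Fin p) (Fin p) ℝ} (hF : IsHurwitz F) (hS : S.PosSemidef)
    (ht0 : 0 ≤ t) (hj : ∀ j, StabRicc F (tj j • S) Q (Pj j)) (hPX : ∀ j, Pj j * Xj j = 1)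
    (htj : Tendsto tj atTop (𝓝 t)) (hXj : Tendsto Xj atTop (𝓝 X)) (hX : Xᵀ = X) :
    X.det ≠ 0 := by
  intro hdet
  have hd : X * Fᵀ + F * X + X * Q * X + t • S = 0 := by
    refine tendsto_nhds_unique ?_ (tendsto_const_nhds (f := atTop (α := ℕ)))
    refine Tendsto.congr (fun j => inv_riccati (hPX j) (hj j).2.1) ?_
    exact (((hXj.mul_const _).add (hXj.const_mul _)).add ((hXj.mul_const Q).mul hXj)).add
      (htj.smul_const S)
  -- On the kernel of `X` the limiting dual equation leaves `Vᵀ (t S) V = 0`, so `t S V = 0` and the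
  -- kernel is invariant under `Fᵀ`.
  have hinv : ∀ V : Matrix (Fin p) (Fin 2) ℝ, X * V = 0 → X * (Fᵀ * V) = 0 := by
    intro V hV
    have hVt : Vᵀ * X = 0 := by
      have := congrArg Matrix.transpose hV
      simpa [hX] using this
    have e : X * (Fᵀ * V) + t • S * V = 0 := by
      have := congrArg (fun M => M * V) hd
      simpa only [Matrix.add_mul, Matrix.mul_assoc, hV, Matrix.mul_zero, add_zero,
        Matrix.zero_mul] using this
    have hz : (Vᵀ * (t • S) * V).trace = 0 := by
      rw [Matrix.mul_assoc, eq_neg_of_add_eq_zero_right e, Matrix.mul_neg, ← Matrix.mul_assoc, hVt,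
        Matrix.zero_mul, neg_zero, Matrix.trace_zero]
    rwa [PosSemidef.mul_eq_zero_of_trace (hS.smul ht0) hz, add_zero] at e
  obtain ⟨σ, ω, V, hV0, hXV, hFV⟩ := exists_eigenvector_of_ker_invariant hdet hinv
  have hσ : σ < 0 := by
    by_contra h
    exact hV0 (isHurwitz_iff.1 hF.transpose σ ω V hFV (not_lt.1 h))
  -- On the kernel, `-(Fᵀ + Q X)` acts as `-Fᵀ` and has the eigenvalue `-(σ + i ω)` with `-σ > 0`,
  -- impossible for a limit of Hurwitz matrices.
  refine hV0 (eq_zero_of_tendsto_isHurwitz (fun j => (hj j).isHurwitz_dual (hPX j))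
    ((tendsto_const_nhds.add (hXj.const_mul Q)).neg) (σ := -σ) (ω := -ω) (neg_pos.2 hσ) ?_)
  have hc : cplx (-σ) (-ω) = -cplx σ ω := by
    ext i j
    fin_cases i <;> fin_cases j <;> simp [cplx]
  rw [hc, Matrix.neg_mul, Matrix.add_mul, Matrix.mul_assoc Q, hXV, Matrix.mul_zero, add_zero, hFV,
    Matrix.mul_neg]

/-- Continuation in `t`. The set of solvable `t` is open to the right by `StabRicc.eventually`. It
is closed because all solutions dominate the Lyapunov solution `P₀`, which is definite as `Q > 0`:
the inverses subconverge, and their limit is invertible. -/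
theorem exists_stabRicc_of_posDef {p q : ℕ} {F Q : Matrix (Fin p) (Fin p) ℝ}
    {G : Matrix (Fin p) (Fin q) ℝ} {θ : ℝ} (hF : IsHurwitz F) (hQ : Q.PosDef)
    (h : FreqBound F G Q θ) (hθ : θ < 1) : ∃ P, StabRicc F (G * Gᵀ) Q P := by
  have hS := posSemidef_mul_transpose_self G
  obtain ⟨P₀, hP₀, hP₀e⟩ := hF.exists_lyapunov hQ.posSemidef
  have hP₀d : P₀.PosDef := by
    rw [hP₀.posDef_iff_det_ne_zero]
    intro h0
    obtain ⟨v, hv0, hv⟩ := Matrix.exists_mulVec_eq_zero_iff.2 h0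
    have hq := hQ.dotProduct_mulVec_pos hv0
    rw [eq_neg_of_add_eq_zero_right hP₀e, Matrix.neg_mulVec, Matrix.add_mulVec,
      ← Matrix.mulVec_mulVec, ← Matrix.mulVec_mulVec, hv, Matrix.mulVec_zero, zero_add,
      dotProduct_neg, Matrix.dotProduct_mulVec, ← Matrix.mulVec_transpose,
      PosSemidef.transpose_eq hP₀] at hq
    simp [hv] at hq
  obtain ⟨c, hc, hcP⟩ := PosDef.exists_lower_bound hP₀d
  let s : Set ℝ := {t | ∃ P, StabRicc F (t • (G * Gᵀ)) Q P}
  have hsub : Set.Icc (0 : ℝ) 1 ⊆ s := by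
    refine IsClosed.Icc_subset_of_forall_mem_nhdsWithin ?_ ⟨P₀, hP₀, by simpa using hP₀e, by
      simpa using hF⟩ ?_
    · rw [← isSeqClosed_iff_isClosed]
      intro tj t htj ht
      have htI : t ∈ Set.Icc (0 : ℝ) 1 :=
        isClosed_Icc.mem_of_tendsto ht (Eventually.of_forall fun j => (htj j).2)
      choose Pj hPj using fun j => (htj j).1
      have hle : ∀ j, (Pj j - P₀).PosSemidef := by
        intro j
        have hsym := PosSemidef.transpose_eq (hPj j).1
        -- With zero quadratic term, the term `P (t G Gᵀ) P` counts as the residual.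
        refine sub_posSemidef_of_riccati (S := 0) (Q := Q) Matrix.PosSemidef.zero
          ⟨hP₀, by simpa using hP₀e, by simpa using hF⟩ hsym
          (M := Pj j * (tj j • (G * Gᵀ)) * Pj j) ?_ ?_
        · have := PosSemidef.congr (hS.smul (htj j).2.1) (Pj j)
          rwa [hsym] at this
        · simpa using (hPj j).2.1
      have hpd : ∀ j, (Pj j).PosDef := fun j => posDef_of_sub_posSemidef hP₀d (hle j)
      have hPX : ∀ j, Pj j * (Pj j)⁻¹ = 1 := fun j =>
        Matrix.mul_nonsing_inv _ ((Matrix.isUnit_iff_isUnit_det _).1 (hpd j).isUnit)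
      have hb : ∀ j, frobSq (Pj j)⁻¹ ≤ p / c ^ 2 := by
        intro j
        refine frobSq_inv_le hc (hpd j) ?_
        have := (hle j).add hcP
        rwa [sub_add_sub_cancel] at this
      obtain ⟨X, φ, hφ, hX⟩ := exists_subseq_tendsto_of_frobSq_le hb
      have hXs : X.PosSemidef := (isClosed_posSemidef p).mem_of_tendsto hX
        (Eventually.of_forall fun j => (hpd (φ j)).inv.posSemidef)
      have htφ := ht.comp hφ.tendsto_atTop
      have hdet := det_ne_zero_of_tendsto hF hS htI.1 (fun j => hPj (φ j)) (fun j => hPX (φ j)) htφ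
        hX (PosSemidef.transpose_eq hXs)
      have hPl := tendsto_inv_of_det_ne_zero hX hdet
      have hPl' : Tendsto (Pj ∘ φ) atTop (𝓝 X⁻¹) := by
        refine hPl.congr fun j => ?_
        exact Matrix.nonsing_inv_nonsing_inv _
          ((Matrix.isUnit_iff_isUnit_det _).1 (hpd (φ j)).isUnit)
      exact ⟨⟨X⁻¹, StabRicc.of_tendsto hF h hθ htI.1 htI.2 (fun j => hPj (φ j)) htφ
        tendsto_const_nhds hPl'⟩, htI⟩
    · rintro t ⟨⟨P, hP⟩, ht⟩
      have hev := hP.eventually (PosSemidef.transpose_eq hS) (PosSemidef.transpose_eq hQ.posSemidef)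
      filter_upwards [hev.filter_mono nhdsWithin_le_nhds, self_mem_nhdsWithin] with t' h' htt'
      obtain ⟨P', hP't, hP'R, hP'H⟩ := h'
      refine ⟨P', ?_, hP'R, hP'H⟩
      have hx := PosSemidef.congr (hS.smul (ht.1.trans (le_of_lt htt'))) P'
      rw [hP't] at hx
      exact hF.posSemidef_of_lyapunov hP't (hQ.posSemidef.add hx) (by rw [← hP'R]; abel)
  obtain ⟨P, hP⟩ := hsub (Set.right_mem_Icc.2 zero_le_one)
  exact ⟨P, by simpa using hP⟩

/-- The strict bounded real lemma: a stabilizing solution of the Riccati equation exists under the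
strict frequency bound. -/
theorem FreqBound.exists_stabRicc {p q : ℕ} {F Q : Matrix (Fin p) (Fin p) ℝ}
    {G : Matrix (Fin p) (Fin q) ℝ} {θ : ℝ} (hF : IsHurwitz F) (hQ : Q.PosSemidef)
    (h : FreqBound F G Q θ) (hθ : θ < 1) : ∃ P, StabRicc F (G * Gᵀ) Q P := by
  obtain ⟨c, hc, hc1⟩ := hF.exists_freqBound_one G
  have hS := posSemidef_mul_transpose_self G
  -- Regularizing `Q` by `ε` costs `ε c` in the frequency bound, less than the slack `1 - θ`.
  set ε : ℝ := (1 - θ) / (2 * (c + 1)) with hεdef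
  have hε : 0 < ε := div_pos (by linarith) (by linarith)
  have hεc : θ + ε * c < 1 := by
    have : ε * (2 * (c + 1)) = 1 - θ := div_mul_cancel₀ _ (by positivity)
    nlinarith
  let e : ℕ → ℝ := fun j => ε * (1 / ((j : ℝ) + 1))
  have he0 : ∀ j, 0 < e j := fun j => by positivity
  have hel : Tendsto e atTop (𝓝 0) := by
    simpa [e] using (tendsto_one_div_add_atTop_nhds_zero_nat (𝕜 := ℝ)).const_mul ε
  have hele : ∀ j, e j ≤ ε := fun j => by
    refine mul_le_of_le_one_right hε.le ?_
    rw [div_le_one (by positivity)]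
    have : (0 : ℝ) ≤ j := j.cast_nonneg
    linarith
  have hex : ∀ δ, 0 < δ → δ ≤ ε →
      ∃ P, StabRicc F (G * Gᵀ) (Q + δ • (1 : Matrix (Fin p) (Fin p) ℝ)) P := by
    intro δ h0 h1
    exact exists_stabRicc_of_posDef hF (Matrix.PosDef.posSemidef_add hQ (Matrix.PosDef.one.smul h0))
      (h.add_smul_one hc1 h0.le) (by nlinarith)
  obtain ⟨P₁, hP₁⟩ := hex ε hε le_rfl
  choose Pj hPj using fun j => hex (e j) (he0 j) (hele j)
  -- Solutions are monotone in the regularization, so the one for `ε` bounds all those for smaller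
  -- parameters.
  have hle : ∀ j, (P₁ - Pj j).PosSemidef := fun j => by
    refine sub_posSemidef_of_riccati hS (hPj j) (PosSemidef.transpose_eq hP₁.1)
      (M := (ε - e j) • (1 : Matrix (Fin p) (Fin p) ℝ))
      (Matrix.PosSemidef.one.smul (sub_nonneg.2 (hele j))) ?_
    rw [← hP₁.2.1, sub_smul]
    abel
  have hb : ∀ j, frobSq (Pj j) ≤ P₁.trace ^ 2 := fun j => by
    refine (PosSemidef.frobSq_le (hPj j).1).trans (pow_le_pow_left₀ (hPj j).1.trace_nonneg ?_ 2)
    have := (hle j).trace_nonneg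
    rwa [Matrix.trace_sub, sub_nonneg] at this
  obtain ⟨P, φ, hφ, hP⟩ := exists_subseq_tendsto_of_frobSq_le hb
  have hQl : Tendsto (fun j => Q + e (φ j) • (1 : Matrix (Fin p) (Fin p) ℝ)) atTop (𝓝 Q) := by
    have := tendsto_const_nhds (x := Q) |>.add
      ((hel.comp hφ.tendsto_atTop).smul_const (1 : Matrix (Fin p) (Fin p) ℝ))
    simpa using this
  refine ⟨P, ?_⟩
  have := StabRicc.of_tendsto (t := 1) (tj := fun _ => 1) hF h hθ zero_le_one le_rfl
    (fun j => by simpa using hPj (φ j)) tendsto_const_nhds hQl hP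
  simpa using this

/-! ### The transfer function and the frequency bound -/

theorem frobSq_reIm {p : ℕ} (v : Fin p → ℂ) : frobSq (reIm v) = ‖WithLp.toLp 2 v‖ ^ 2 := by
  rw [EuclideanSpace.norm_sq_eq, frobSq]
  refine Finset.sum_congr rfl fun i _ => ?_
  rw [Fin.sum_univ_two, Complex.sq_norm, Complex.normSq_apply]
  simp [reIm, sq]

theorem IsHurwitz.isUnit_imag_sub {p : ℕ} {F : Matrix (Fin p) (Fin p) ℝ} (hF : IsHurwitz F)
    (ω : ℝ) : IsUnit (((ω : ℂ) * Complex.I) • (1 : Matrix (Fin p) (Fin p) ℂ) - toC F) := by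
  have h : (ω : ℂ) * Complex.I ∉ spectrum ℂ (toC F) := fun h => by simpa using hF _ h
  rwa [spectrum.notMem_iff, Algebra.algebraMap_eq_smul_one] at h

theorem reIm_imag_smul {p : ℕ} (ω : ℝ) (v : Fin p → ℂ) :
    reIm (((ω : ℂ) * Complex.I) • v) = reIm v * cplx 0 ω := by
  rw [reIm_smul]
  simp

theorem IsHurwitz.exists_response {p q : ℕ} {F : Matrix (Fin p) (Fin p) ℝ} (hF : IsHurwitz F)
    (G : Matrix (Fin p) (Fin q) ℝ) (ω : ℝ) (W : Matrix (Fin q) (Fin 2) ℝ) :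
    ∃ X : Matrix (Fin p) (Fin 2) ℝ, F * X + G * W = X * cplx 0 ω := by
  set s := (ω : ℂ) * Complex.I with hs
  set N := s • (1 : Matrix (Fin p) (Fin p) ℂ) - toC F with hN
  have hu : N * N⁻¹ = 1 :=
    Matrix.mul_nonsing_inv _ ((Matrix.isUnit_iff_isUnit_det _).1 (hF.isUnit_imag_sub ω))
  set ξ := N⁻¹ *ᵥ (toC G *ᵥ ofReIm W) with hξ
  have h : N *ᵥ ξ = toC G *ᵥ ofReIm W := by
    rw [hξ, Matrix.mulVec_mulVec, hu, Matrix.one_mulVec]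
  rw [hN, Matrix.sub_mulVec, sub_eq_iff_eq_add', Matrix.smul_mulVec, Matrix.one_mulVec] at h
  have h2 := congrArg reIm h
  rw [reIm_add, reIm_mulVec, reIm_mulVec, reIm_ofReIm, reIm_imag_smul] at h2
  exact ⟨reIm ξ, h2.symm⟩

theorem IsHurwitz.reIm_transferFunction {p q r : ℕ} {F : Matrix (Fin p) (Fin p) ℝ}
    (hF : IsHurwitz F) {G : Matrix (Fin p) (Fin q) ℝ} (H : Matrix (Fin r) (Fin p) ℝ) {ω : ℝ}
    {X : Matrix (Fin p) (Fin 2) ℝ} {w : Fin q → ℂ} (h : F * X + G * reIm w = X * cplx 0 ω) :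
    reIm (transferFunction F G H ((ω : ℂ) * Complex.I) *ᵥ w) = H * X := by
  set s := (ω : ℂ) * Complex.I with hs
  set N := s • (1 : Matrix (Fin p) (Fin p) ℂ) - toC F with hN
  have hu : N⁻¹ * N = 1 :=
    Matrix.nonsing_inv_mul _ ((Matrix.isUnit_iff_isUnit_det _).1 (hF.isUnit_imag_sub ω))
  have h1 : N *ᵥ ofReIm X = toC G *ᵥ w := by
    rw [hN, Matrix.sub_mulVec, sub_eq_iff_eq_add', Matrix.smul_mulVec, Matrix.one_mulVec]
    apply reIm_injective
    rw [reIm_imag_smul, reIm_add, reIm_mulVec, reIm_mulVec, reIm_ofReIm, h]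
  have h2 : N⁻¹ *ᵥ (toC G *ᵥ w) = ofReIm X := by
    rw [← h1, Matrix.mulVec_mulVec, hu, Matrix.one_mulVec]
  rw [transferFunction, ← Matrix.mulVec_mulVec, ← Matrix.mulVec_mulVec, h2, reIm_mulVec,
    reIm_ofReIm]

theorem trace_gram {p q r : ℕ} (H : Matrix (Fin r) (Fin p) ℝ) (X : Matrix (Fin p) (Fin q) ℝ) :
    (Xᵀ * (Hᵀ * H) * X).trace = frobSq (H * X) := by
  rw [frobSq_eq_trace, Matrix.transpose_mul]
  simp only [Matrix.mul_assoc]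

theorem norm_mulVec_le_opNorm {p q : ℕ} (T : Matrix (Fin p) (Fin q) ℂ) (w : Fin q → ℂ) :
    ‖WithLp.toLp 2 (T *ᵥ w)‖ ≤ opNorm T * ‖WithLp.toLp 2 w‖ :=
  Matrix.l2_opNorm_mulVec T (WithLp.toLp 2 w)

theorem exists_freqBound_of_hInfNorm_lt {p q r : ℕ} {F : Matrix (Fin p) (Fin p) ℝ}
    (hF : IsHurwitz F) {D : Matrix (Fin p) (Fin q) ℝ} {H : Matrix (Fin r) (Fin p) ℝ} {γ : ℝ}
    (hγ : 0 < γ) (h : hInfNorm (transferFunction F D H) < ENNReal.ofReal γ) :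
    ∃ θ < 1, FreqBound F (γ⁻¹ • D) (Hᵀ * H) θ := by
  set ρ := (hInfNorm (transferFunction F D H)).toReal with hρ
  have hρ0 : 0 ≤ ρ := ENNReal.toReal_nonneg
  have hρ1 : ρ < γ := ENNReal.toReal_lt_of_lt_ofReal h
  have hne : hInfNorm (transferFunction F D H) ≠ ⊤ := (h.trans_le le_top).ne
  have hle : ∀ ω : ℝ, opNorm (transferFunction F D H ((ω : ℂ) * Complex.I)) ≤ ρ := fun ω =>
    (ENNReal.ofReal_le_iff_le_toReal hne).1
      (le_iSup (fun ω : ℝ => ENNReal.ofReal (opNorm (transferFunction F D H (ω * Complex.I)))) ω)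
  -- The input matrix is `γ⁻¹ D`, so `W` stands for the disturbance `γ⁻¹ W`; `ρ` is the `H_∞` norm.
  refine ⟨(ρ / γ) ^ 2, ?_, fun ω X W hX => ?_⟩
  · rw [sq_lt_one_iff₀ (by positivity), div_lt_one hγ]
    exact hρ1
  · set w := ofReIm (γ⁻¹ • W) with hw
    have hX' : F * X + D * reIm w = X * cplx 0 ω := by
      rw [hw, reIm_ofReIm, ← hX, Matrix.mul_smul, Matrix.smul_mul]
    have hz := hF.reIm_transferFunction H hX'
    rw [trace_gram, ← hz, frobSq_reIm]
    have hn := norm_mulVec_le_opNorm (transferFunction F D H ((ω : ℂ) * Complex.I)) w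
    have hwn : ‖WithLp.toLp 2 w‖ ^ 2 = (γ⁻¹) ^ 2 * frobSq W := by
      rw [← frobSq_reIm, hw, reIm_ofReIm, frobSq_smul]
    calc _ ≤ (ρ * ‖WithLp.toLp 2 w‖) ^ 2 :=
          pow_le_pow_left₀ (norm_nonneg _)
            (hn.trans (mul_le_mul_of_nonneg_right (hle ω) (norm_nonneg _))) 2
      _ = (ρ / γ) ^ 2 * frobSq W := by rw [mul_pow, hwn]; ring

-- The norm is attained on the compact unit sphere, so the strict inequality survives the supremum.
open scoped Matrix.Norms.L2Operator in
theorem opNorm_lt_of_forall {p q : ℕ} {T : Matrix (Fin p) (Fin q) ℂ} {γ : ℝ} (hγ : 0 < γ)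
    (h : ∀ w : Fin q → ℂ, w ≠ 0 → ‖WithLp.toLp 2 (T *ᵥ w)‖ < γ * ‖WithLp.toLp 2 w‖) :
    opNorm T < γ := by
  let L : EuclideanSpace ℂ (Fin q) →L[ℂ] EuclideanSpace ℂ (Fin p) :=
    LinearMap.toContinuousLinearMap (Matrix.toEuclideanLin T)
  have hL : opNorm T = ‖L‖ := Matrix.l2_opNorm_def T
  have hLw : ∀ w, ‖L w‖ = ‖WithLp.toLp 2 (T *ᵥ w.ofLp)‖ := fun w => rfl
  rw [hL]
  rcases (Metric.sphere (0 : EuclideanSpace ℂ (Fin q)) 1).eq_empty_or_nonempty with he | hne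
  · refine lt_of_le_of_lt (ContinuousLinearMap.opNorm_le_of_unit_norm le_rfl fun w hw => ?_) hγ
    exact absurd (show w ∈ Metric.sphere (0 : EuclideanSpace ℂ (Fin q)) 1 by simpa using hw)
      (by rw [he]; exact Set.notMem_empty _)
  · obtain ⟨v, hv, hmax⟩ := (isCompact_sphere (0 : EuclideanSpace ℂ (Fin q)) 1).exists_isMaxOn hne
      (f := fun w => ‖L w‖) L.continuous.norm.continuousOn
    have hv1 : ‖v‖ = 1 := by simpa using hv
    refine lt_of_le_of_lt (ContinuousLinearMap.opNorm_le_of_unit_norm (norm_nonneg (L v))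
      fun w hw => hmax (by simpa using hw)) ?_
    have hv0 : v.ofLp ≠ 0 := fun h0 => by
      have : v = 0 := by ext i; simpa using congrFun h0 i
      rw [this, norm_zero] at hv1
      exact zero_ne_one hv1
    have := h v.ofLp hv0
    rw [hLw]
    simpa [hv1] using this

open scoped Matrix.Norms.L2Operator in
theorem IsHurwitz.continuous_transferFunction {p q r : ℕ} {F : Matrix (Fin p) (Fin p) ℝ}
    (hF : IsHurwitz F) (D : Matrix (Fin p) (Fin q) ℝ) (H : Matrix (Fin r) (Fin p) ℝ) :
    Continuous fun ω : ℝ => transferFunction F D H ((ω : ℂ) * Complex.I) := by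
  have h : Continuous fun ω : ℝ => resolvent (toC F) ((ω : ℂ) * Complex.I) := by
    rw [continuous_iff_continuousAt]
    intro ω
    have hu : (ω : ℂ) * Complex.I ∈ resolventSet ℂ (toC F) := by
      rw [spectrum.mem_resolventSet_iff, Algebra.algebraMap_eq_smul_one]
      exact hF.isUnit_imag_sub ω
    have h1 := (spectrum.hasDerivAt_resolvent_const_left hu).continuousAt
    have h2 : Continuous fun ω : ℝ => (ω : ℂ) * Complex.I := by fun_prop
    exact ContinuousAt.comp (f := fun ω : ℝ => (ω : ℂ) * Complex.I) h1 h2.continuousAt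
  have e : (fun ω : ℝ => transferFunction F D H ((ω : ℂ) * Complex.I))
      = fun ω : ℝ => toC H * resolvent (toC F) ((ω : ℂ) * Complex.I) * toC D := by
    funext ω
    rw [transferFunction, Matrix.nonsing_inv_eq_ringInverse, resolvent,
      Algebra.algebraMap_eq_smul_one]
  rw [e]
  exact (continuous_const.matrix_mul h).matrix_mul continuous_const

open scoped Matrix.Norms.L2Operator in
theorem tendsto_transferFunction_cocompact {p q r : ℕ} (F : Matrix (Fin p) (Fin p) ℝ)
    (D : Matrix (Fin p) (Fin q) ℝ) (H : Matrix (Fin r) (Fin p) ℝ) :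
    Tendsto (fun ω : ℝ => transferFunction F D H ((ω : ℂ) * Complex.I)) (cocompact ℝ) (𝓝 0) := by
  have h2 : Tendsto (fun ω : ℝ => (ω : ℂ) * Complex.I) (cocompact ℝ) (Bornology.cobounded ℂ) := by
    rw [← tendsto_norm_atTop_iff_cobounded]
    refine (tendsto_norm_cocompact_atTop (E := ℝ)).congr fun ω => ?_
    simp
  have h := (spectrum.resolvent_tendsto_cobounded (𝕜 := ℂ) (toC F)).comp h2
  have hc : Continuous fun M : Matrix (Fin p) (Fin p) ℂ => toC H * M * toC D :=
    (continuous_const.matrix_mul continuous_id).matrix_mul continuous_const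
  have h3 := (hc.tendsto 0).comp h
  rw [Matrix.mul_zero, Matrix.zero_mul] at h3
  refine h3.congr fun ω => ?_
  simp only [Function.comp_apply]
  rw [transferFunction, Matrix.nonsing_inv_eq_ringInverse, resolvent,
    Algebra.algebraMap_eq_smul_one]

-- The frequency response is continuous and vanishes at infinity, so its norm attains its supremum
-- over the line and pointwise strictness is enough.
open scoped Matrix.Norms.L2Operator in
theorem hInfNorm_lt_of_forall {p q r : ℕ} {F : Matrix (Fin p) (Fin p) ℝ}
    (hF : IsHurwitz F) {D : Matrix (Fin p) (Fin q) ℝ} {H : Matrix (Fin r) (Fin p) ℝ} {γ : ℝ}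
    (hγ : 0 < γ) (h : ∀ (ω : ℝ) (X : Matrix (Fin p) (Fin 2) ℝ) (W : Matrix (Fin q) (Fin 2) ℝ),
      F * X + (γ⁻¹ • D) * W = X * cplx 0 ω → W ≠ 0 → (Xᵀ * (Hᵀ * H) * X).trace < frobSq W) :
    hInfNorm (transferFunction F D H) < ENNReal.ofReal γ := by
  have hlt : ∀ ω : ℝ, opNorm (transferFunction F D H ((ω : ℂ) * Complex.I)) < γ := by
    intro ω
    refine opNorm_lt_of_forall hγ fun w hw => ?_
    obtain ⟨X, hX⟩ := hF.exists_response D ω (reIm w)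
    have hX' : F * X + (γ⁻¹ • D) * (γ • reIm w) = X * cplx 0 ω := by
      rw [← hX, Matrix.smul_mul, Matrix.mul_smul, smul_smul, inv_mul_cancel₀ hγ.ne', one_smul]
    have hW : γ • reIm w ≠ 0 := smul_ne_zero hγ.ne' (mt reIm_eq_zero_iff.1 hw)
    have hs := h ω X _ hX' hW
    rw [trace_gram, ← hF.reIm_transferFunction H hX, frobSq_reIm, frobSq_smul, frobSq_reIm,
      ← mul_pow] at hs
    exact lt_of_pow_lt_pow_left₀ 2 (by positivity) hs
  set f : ℝ → ℝ := fun ω => opNorm (transferFunction F D H ((ω : ℂ) * Complex.I)) with hf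
  have hfc : Continuous f := (hF.continuous_transferFunction D H).norm
  have hft : Tendsto f (cocompact ℝ) (𝓝 0) := by
    have := (tendsto_transferFunction_cocompact F D H).norm
    rwa [norm_zero] at this
  obtain ⟨ω₁, h₁⟩ : ∃ ω₁, ∀ ω, f ω ≤ f ω₁ := by
    by_cases hpos : ∃ ω₀, 0 < f ω₀
    · obtain ⟨ω₀, h₀⟩ := hpos
      exact hfc.exists_forall_ge' ω₀ ((hft.eventually (gt_mem_nhds h₀)).mono fun _ hx => hx.le)
    · push Not at hpos
      exact ⟨0, fun ω => (hpos ω).trans (opNorm_nonneg _)⟩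
  refine lt_of_le_of_lt (iSup_le fun ω => ENNReal.ofReal_le_ofReal (h₁ ω)) ?_
  exact (ENNReal.ofReal_lt_ofReal_iff hγ).2 (hlt ω₁)

/-! ### Dissipation inequalities: the converse of the bounded real lemma -/

/-- For a mode with `σ ≥ 0` every term of the energy identity vanishes, so `M X = 0` and `Gᵀ P X =
0`. Then `X` is also a mode of the Hurwitz matrix `F₁`, which acts as a detectability certificate.
-/
theorem isHurwitz_of_dissipation {p q : ℕ} {F Q P M F₁ : Matrix (Fin p) (Fin p) ℝ}
    {G : Matrix (Fin p) (Fin q) ℝ} (hP : P.PosSemidef) (hQ : Q.PosSemidef) (hM : M.PosSemidef)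
    (hR : Fᵀ * P + P * F + Q + P * (G * Gᵀ) * P + M = 0) (hF₁ : IsHurwitz F₁)
    (hMF : ∀ X : Matrix (Fin p) (Fin 2) ℝ, M * X = 0 → (F + G * Gᵀ * P) * X = F₁ * X) :
    IsHurwitz F := by
  have hPt := PosSemidef.transpose_eq hP
  rw [isHurwitz_iff]
  intro σ ω X hX hσ
  have he := trace_energy hPt (Z := 0) (by rw [hX, add_zero])
  have hq : Fᵀ * P + P * F = -(Q + P * (G * Gᵀ) * P + M) := by
    rw [← sub_eq_zero, sub_neg_eq_add, ← hR]
    abel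
  have e2 : (Xᵀ * (P * (G * Gᵀ) * P) * X).trace = frobSq (Gᵀ * P * X) := by
    rw [frobSq_eq_trace]
    simp only [Matrix.transpose_mul, hPt, Matrix.transpose_transpose, Matrix.mul_assoc]
  rw [hq, Matrix.mul_neg, Matrix.neg_mul, Matrix.trace_neg, Matrix.mul_add, Matrix.add_mul,
    Matrix.trace_add, Matrix.mul_add, Matrix.add_mul, Matrix.trace_add, e2, Matrix.mul_zero,
    Matrix.trace_zero, add_zero] at he
  have h1 := PosSemidef.trace_congr_nonneg hQ X
  have h2 := PosSemidef.trace_congr_nonneg hM X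
  have h3 := frobSq_nonneg (Gᵀ * P * X)
  have h4 := mul_nonneg hσ (PosSemidef.trace_congr_nonneg hP X)
  have hMX := PosSemidef.mul_eq_zero_of_trace hM (X := X) (by linarith)
  have hGX : Gᵀ * P * X = 0 := frobSq_eq_zero_iff.1 (by linarith)
  have h5 := hMF X hMX
  rw [Matrix.add_mul, Matrix.mul_assoc G, Matrix.mul_assoc G, hGX, Matrix.mul_zero, add_zero,
    hX] at h5
  exact isHurwitz_iff.1 hF₁ σ ω X h5.symm hσ

/-- Completing the square, `‖W‖² - tr (Xᵀ Q X) = ‖W - Gᵀ P X‖² + tr (Xᵀ M X)`. Equality would make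
`X` a mode of `F₁` at `i ω`, so `X = 0` and `W = 0`. -/
theorem trace_lt_of_dissipation {p q : ℕ} {F Q P M F₁ : Matrix (Fin p) (Fin p) ℝ}
    {G : Matrix (Fin p) (Fin q) ℝ} (hP : Pᵀ = P) (hM : M.PosSemidef)
    (hR : Fᵀ * P + P * F + Q + P * (G * Gᵀ) * P + M = 0) (hF₁ : IsHurwitz F₁)
    (hMF : ∀ X : Matrix (Fin p) (Fin 2) ℝ, M * X = 0 → (F + G * Gᵀ * P) * X = F₁ * X)
    {ω : ℝ} {X : Matrix (Fin p) (Fin 2) ℝ} {W : Matrix (Fin q) (Fin 2) ℝ}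
    (hX : F * X + G * W = X * cplx 0 ω) (hW : W ≠ 0) : (Xᵀ * Q * X).trace < frobSq W := by
  have he := trace_energy hP (Z := -(G * W))
    (by rw [← sub_eq_add_neg]; exact eq_sub_of_add_eq hX)
  have hq : Fᵀ * P + P * F = -(Q + P * (G * Gᵀ) * P + M) := by
    rw [← sub_eq_zero, sub_neg_eq_add, ← hR]
    abel
  have e2 : (Xᵀ * (P * (G * Gᵀ) * P) * X).trace = frobSq (Gᵀ * P * X) := by
    rw [frobSq_eq_trace]
    simp only [Matrix.transpose_mul, hP, Matrix.transpose_transpose, Matrix.mul_assoc]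
  have e3 : (Xᵀ * P * -(G * W)).trace = -((Wᵀ * (Gᵀ * P * X)).trace) := by
    rw [trace_transpose_mul_comm, Matrix.mul_neg, Matrix.trace_neg]
    simp only [Matrix.transpose_mul, hP, Matrix.transpose_transpose, Matrix.mul_assoc]
  rw [hq, Matrix.mul_neg, Matrix.neg_mul, Matrix.trace_neg, Matrix.mul_add, Matrix.add_mul,
    Matrix.trace_add, Matrix.mul_add, Matrix.add_mul, Matrix.trace_add, e2, e3] at he
  have h1 := frobSq_sub W (Gᵀ * P * X)
  have h2 := PosSemidef.trace_congr_nonneg hM X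
  have h3 := frobSq_nonneg (W - Gᵀ * P * X)
  by_contra hlt
  push Not at hlt
  have hMX := PosSemidef.mul_eq_zero_of_trace hM (X := X) (by linarith)
  have hGX : W - Gᵀ * P * X = 0 := frobSq_eq_zero_iff.1 (by linarith)
  have h5 := hMF X hMX
  rw [Matrix.add_mul, Matrix.mul_assoc G, Matrix.mul_assoc G, ← sub_eq_zero.1 hGX, hX] at h5
  have hX0 := isHurwitz_iff.1 hF₁ 0 ω X h5.symm le_rfl
  exact hW (by rw [sub_eq_zero.1 hGX, hX0, Matrix.mul_zero])

/-! ### Feasible gains and stabilizing solutions -/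

namespace Problem

variable {m d n l : ℕ} (S : Problem m d n l)

/-- The disturbance matrix scaled by the attenuation level. -/
noncomputable def G : Matrix (Fin m) (Fin n) ℝ := S.γ⁻¹ • S.D

/-- The Gram matrix of the closed-loop output matrix. -/
def outputGram (K : Matrix (Fin d) (Fin m) ℝ) : Matrix (Fin m) (Fin m) ℝ :=
  S.Cᵀ * S.C + Kᵀ * S.R * K

theorem G_mul_transpose : S.G * S.Gᵀ = (S.γ ^ 2)⁻¹ • (S.D * S.Dᵀ) := by
  rw [G, Matrix.transpose_smul, Matrix.smul_mul, Matrix.mul_smul, smul_smul, sq, mul_inv]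

variable {S}

theorem isStabilizingSolution_iff {K : Matrix (Fin d) (Fin m) ℝ} {P : Matrix (Fin m) (Fin m) ℝ} :
    S.IsStabilizingSolution K P ↔
      StabRicc (S.A - S.B * K) (S.G * S.Gᵀ) (S.outputGram K) P := by
  rw [IsStabilizingSolution, StabRicc, G_mul_transpose, outputGram, Matrix.mul_smul,
    Matrix.smul_mul, Matrix.smul_mul]
  simp only [Matrix.mul_assoc, add_assoc]

theorem posSemidef_R : S.R.PosSemidef := posSemidef_transpose_mul_self S.E

theorem R_transpose : S.Rᵀ = S.R := PosSemidef.transpose_eq posSemidef_R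

theorem posSemidef_outputGram (K : Matrix (Fin d) (Fin m) ℝ) : (S.outputGram K).PosSemidef :=
  (posSemidef_transpose_mul_self S.C).add (PosSemidef.congr posSemidef_R K)

theorem exists_freqBound (hS : S.Standing) {K : Matrix (Fin d) (Fin m) ℝ} (hK : K ∈ S.feasible) :
    ∃ θ < 1, FreqBound (S.A - S.B * K) S.G (S.outputGram K) θ := by
  have := exists_freqBound_of_hInfNorm_lt hK.1 hS.1 hK.2
  rwa [S.gram_output hS] at this

theorem isStabilizingSolution_ricc (hS : S.Standing) {K : Matrix (Fin d) (Fin m) ℝ}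
    (hK : K ∈ S.feasible) : S.IsStabilizingSolution K (S.ricc K) := by
  obtain ⟨θ, hθ, h⟩ := exists_freqBound hS hK
  obtain ⟨P, hP⟩ := h.exists_stabRicc hK.1 (posSemidef_outputGram K) hθ
  have hP' := isStabilizingSolution_iff.2 hP
  rwa [ricc_eq hP']

theorem mem_feasible_of_dissipation (hS : S.Standing) {K : Matrix (Fin d) (Fin m) ℝ}
    {P M F₁ : Matrix (Fin m) (Fin m) ℝ} (hP : P.PosSemidef) (hM : M.PosSemidef)
    (hR : (S.A - S.B * K)ᵀ * P + P * (S.A - S.B * K) + S.outputGram K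
      + P * (S.G * S.Gᵀ) * P + M = 0) (hF₁ : IsHurwitz F₁)
    (hMF : ∀ X : Matrix (Fin m) (Fin 2) ℝ, M * X = 0 →
      (S.A - S.B * K + S.G * S.Gᵀ * P) * X = F₁ * X) : K ∈ S.feasible := by
  have hF := isHurwitz_of_dissipation hP (posSemidef_outputGram K) hM hR hF₁ hMF
  refine ⟨hF, hInfNorm_lt_of_forall hF hS.1 fun ω X W hX hW => ?_⟩
  rw [S.gram_output hS]
  exact trace_lt_of_dissipation (PosSemidef.transpose_eq hP) hM hR hF₁ hMF hX hW

theorem IsStabilizingSolution.mem_feasible (hS : S.Standing) {K : Matrix (Fin d) (Fin m) ℝ}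
    {P : Matrix (Fin m) (Fin m) ℝ} (h : S.IsStabilizingSolution K P) : K ∈ S.feasible := by
  obtain ⟨h1, h2, h3⟩ := isStabilizingSolution_iff.1 h
  exact mem_feasible_of_dissipation hS h1 Matrix.PosSemidef.zero (by rw [h2, add_zero]) h3
    fun X _ => rfl

end Problem

/-! ### Stationary gains and the effect of one step -/

namespace Problem

variable {m d n l : ℕ} {S : Problem m d n l}

variable (S) in
/-- The natural gradient direction `R K - Bᵀ P_K`. -/
noncomputable def grad (K : Matrix (Fin d) (Fin m) ℝ) : Matrix (Fin d) (Fin m) ℝ :=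
  S.R * K - S.Bᵀ * S.ricc K

theorem isUnit_R (hS : S.Standing) : IsUnit S.R.det :=
  (Matrix.isUnit_iff_isUnit_det _).1 hS.2.2.isUnit

/-- Stationarity cancels `Kᵀ R K` against `Kᵀ Bᵀ P`, leaving the costate equation, with the
open-loop `Aᵀ` on the left. -/
theorem riccati_of_stationary {K : Matrix (Fin d) (Fin m) ℝ} {P : Matrix (Fin m) (Fin m) ℝ}
    (hR : (S.A - S.B * K)ᵀ * P + P * (S.A - S.B * K) + S.outputGram K
      + P * (S.G * S.Gᵀ) * P = 0) (hK : S.R * K = S.Bᵀ * P) :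
    S.Aᵀ * P + P * (S.A - S.B * K + S.G * S.Gᵀ * P) + S.Cᵀ * S.C = 0 := by
  rw [outputGram, Matrix.mul_assoc Kᵀ, hK] at hR
  rw [← hR, Matrix.transpose_sub, Matrix.transpose_mul]
  simp only [Matrix.mul_add, Matrix.sub_mul, Matrix.mul_sub, Matrix.mul_assoc]
  abel

/-- A stationary solution of the Riccati equation has no closed-loop eigenvalues on the imaginary
axis as soon as some gain is feasible and the plant is detectable. -/
theorem eq_zero_of_stationary (hS : S.Standing) (hdet : IsDetectable S.A S.C)
    {K₀ K : Matrix (Fin d) (Fin m) ℝ} (hK₀ : K₀ ∈ S.feasible) {P : Matrix (Fin m) (Fin m) ℝ}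
    (hP : Pᵀ = P) (hR : (S.A - S.B * K)ᵀ * P + P * (S.A - S.B * K) + S.outputGram K
      + P * (S.G * S.Gᵀ) * P = 0) (hK : S.R * K = S.Bᵀ * P) {ω : ℝ}
    {X : Matrix (Fin m) (Fin 2) ℝ}
    (hX : (S.A - S.B * K + S.G * S.Gᵀ * P) * X = X * cplx 0 ω) : X = 0 := by
  set W := S.Gᵀ * P * X with hW
  have hXW : (S.A - S.B * K) * X + S.G * W = X * cplx 0 ω := by
    rw [← hX, hW, Matrix.add_mul]
    simp only [Matrix.mul_assoc]
  have hsplit : ∀ (K : Matrix (Fin d) (Fin m) ℝ) (X : Matrix (Fin m) (Fin 2) ℝ),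
      (Xᵀ * S.outputGram K * X).trace
        = (Xᵀ * (S.Cᵀ * S.C) * X).trace + ((K * X)ᵀ * S.R * (K * X)).trace := by
    intro K X
    rw [outputGram, Matrix.mul_add, Matrix.add_mul, Matrix.trace_add, Matrix.transpose_mul]
    simp only [Matrix.mul_assoc]
  have henergy : (Xᵀ * S.outputGram K * X).trace = frobSq W := by
    have he := trace_energy hP (Z := -(S.G * W))
      (by rw [← sub_eq_add_neg]; exact eq_sub_of_add_eq hXW)
    have hq : (S.A - S.B * K)ᵀ * P + P * (S.A - S.B * K)
        = -(S.outputGram K + P * (S.G * S.Gᵀ) * P) := by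
      rw [← sub_eq_zero, sub_neg_eq_add, ← hR, ← add_assoc]
    have e2 : (Xᵀ * (P * (S.G * S.Gᵀ) * P) * X).trace = frobSq W := by
      rw [frobSq_eq_trace, hW]
      simp only [Matrix.transpose_mul, hP, Matrix.transpose_transpose, Matrix.mul_assoc]
    have e3 : (Xᵀ * P * -(S.G * W)).trace = -frobSq W := by
      rw [frobSq_eq_trace, Matrix.mul_neg, Matrix.trace_neg]
      nth_rewrite 2 [hW]
      simp only [Matrix.transpose_mul, hP, Matrix.transpose_transpose, Matrix.mul_assoc]
    rw [hq, Matrix.mul_neg, Matrix.neg_mul, Matrix.trace_neg, Matrix.mul_add, Matrix.add_mul,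
      Matrix.trace_add, e2, e3] at he
    linarith
  -- Without disturbance the output energy is zero, so `C X = 0` and `K X = 0`: an imaginary mode of
  -- `A` that `C` does not see.
  by_cases hW0 : W = 0
  · rw [hW0, frobSq_eq_zero_iff.2 rfl, hsplit] at henergy
    have h1 := PosSemidef.trace_congr_nonneg (posSemidef_transpose_mul_self S.C) X
    have h2 := PosSemidef.trace_congr_nonneg (posSemidef_R (S := S)) (K * X)
    have hCX : S.C * X = 0 := by
      rw [← frobSq_eq_zero_iff, ← trace_gram]
      linarith
    have hKX : K * X = 0 := by
      have h3 := PosSemidef.mul_eq_zero_of_trace (posSemidef_R (S := S)) (X := K * X) (by linarith)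
      rw [← Matrix.nonsing_inv_mul_cancel_left (A := S.R) (K * X) (isUnit_R hS), h3,
        Matrix.mul_zero]
    obtain ⟨L, hL⟩ := hdet
    rw [hW0, Matrix.mul_zero, add_zero, Matrix.sub_mul, Matrix.mul_assoc, hKX, Matrix.mul_zero,
      sub_zero] at hXW
    refine isHurwitz_iff.1 hL 0 ω X ?_ le_rfl
    rw [Matrix.sub_mul, Matrix.mul_assoc, hCX, Matrix.mul_zero, sub_zero, hXW]
  · exfalso
    obtain ⟨θ, hθ, hb⟩ := exists_freqBound hS hK₀
    -- The feasible gain `K₀` is driven by the same disturbance at the same frequency; its output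
    -- energy is strictly below `‖W‖²`.
    obtain ⟨X', hX'⟩ := hK₀.1.exists_response S.G ω W
    have hlt := hb ω X' W hX'
    have hWpos : 0 < frobSq W := lt_of_le_of_ne (frobSq_nonneg W)
      fun h => hW0 (frobSq_eq_zero_iff.1 h.symm)
    set Y := X' - X with hY
    set V := K₀ * X' - K * X with hV
    have hAY : S.A * Y = Y * cplx 0 ω + S.B * V := by
      rw [hY, hV, Matrix.sub_mul, ← hX', ← hXW]
      simp only [Matrix.mul_sub, Matrix.sub_mul, Matrix.mul_assoc]
      abel
    have hstat : S.Cᵀ * S.C * X = -(S.Aᵀ * P * X) - P * (X * cplx 0 ω) := by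
      have h := congrArg (fun M => M * X) (riccati_of_stationary hR hK)
      simp only [Matrix.add_mul, Matrix.zero_mul, Matrix.mul_assoc P, hX] at h
      rw [← sub_eq_zero, ← h]
      abel
    have hsk : (cplx 0 ω)ᵀ = -cplx 0 ω := by
      ext i j
      fin_cases i <;> fin_cases j <;> simp [cplx]
    -- First-order optimality: the stationary response is orthogonal to the difference `(Y, V)` of
    -- the two responses, which obeys the undisturbed plant. Hence no response to `W` has less
    -- energy than `‖W‖²`.
    have horth : (Yᵀ * (S.Cᵀ * S.C) * X).trace + (Vᵀ * S.R * (K * X)).trace = 0 := by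
      have e1 : (Yᵀ * (S.Aᵀ * P * X)).trace
          = -(Yᵀ * (P * (X * cplx 0 ω))).trace + (Vᵀ * S.R * (K * X)).trace := by
        have e2 : Yᵀ * (S.Aᵀ * P * X) = (S.A * Y)ᵀ * (P * X) := by
          rw [Matrix.transpose_mul]
          simp only [Matrix.mul_assoc]
        rw [e2, hAY, Matrix.transpose_add, Matrix.transpose_mul, hsk, Matrix.transpose_mul,
          Matrix.add_mul, Matrix.trace_add, Matrix.neg_mul, Matrix.neg_mul, Matrix.trace_neg,
          Matrix.mul_assoc (cplx 0 ω), Matrix.trace_mul_comm (cplx 0 ω)]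
        congr 2
        · simp only [Matrix.mul_assoc]
        · rw [Matrix.mul_assoc Vᵀ S.R, ← Matrix.mul_assoc S.R, hK]
          simp only [Matrix.mul_assoc]
      rw [Matrix.mul_assoc, hstat, Matrix.mul_sub, Matrix.mul_neg, Matrix.trace_sub,
        Matrix.trace_neg, e1]
      ring
    have hX'e : X' = X + Y := by rw [hY]; abel
    have hK'e : K₀ * X' = K * X + V := by rw [hV]; abel
    have hquad : ∀ {a : ℕ} (N : Matrix (Fin a) (Fin a) ℝ) (Z Z' : Matrix (Fin a) (Fin 2) ℝ),
        N.PosSemidef → (Zᵀ * N * Z).trace + 2 * (Z'ᵀ * N * Z).trace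
          ≤ ((Z + Z')ᵀ * N * (Z + Z')).trace := by
      intro a N Z Z' hN
      have h1 := PosSemidef.trace_congr_nonneg hN Z'
      have h2 : (Zᵀ * N * Z').trace = (Z'ᵀ * N * Z).trace := by
        rw [← Matrix.trace_transpose]
        simp [PosSemidef.transpose_eq hN, Matrix.mul_assoc]
      rw [Matrix.transpose_add, Matrix.add_mul, Matrix.add_mul, Matrix.mul_add, Matrix.mul_add,
        Matrix.trace_add, Matrix.trace_add, Matrix.trace_add, h2]
      linarith
    have q1 := hquad _ X Y (posSemidef_transpose_mul_self S.C)
    have q2 := hquad _ (K * X) V (posSemidef_R (S := S))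
    rw [hsplit, hX'e, ← hX'e, hK'e, hX'e] at hlt
    rw [hsplit] at henergy
    nlinarith

/-- The cross terms agree, `Kᵀ Bᵀ P' = Kᵀ R K' = P B K'`, so `P - P'` solves the homogeneous
Sylvester equation of the two Hurwitz closed loops. -/
theorem stationary_unique (hS : S.Standing) {K K' : Matrix (Fin d) (Fin m) ℝ}
    (hK : K ∈ S.feasible) (hK' : K' ∈ S.feasible) (h : K = S.R⁻¹ * S.Bᵀ * S.ricc K)
    (h' : K' = S.R⁻¹ * S.Bᵀ * S.ricc K') : K = K' := by
  have hRK : ∀ {K : Matrix (Fin d) (Fin m) ℝ}, K = S.R⁻¹ * S.Bᵀ * S.ricc K →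
      S.R * K = S.Bᵀ * S.ricc K := by
    intro K h
    nth_rewrite 1 [h]
    rw [Matrix.mul_assoc, Matrix.mul_nonsing_inv_cancel_left _ _ (isUnit_R hS)]
  obtain ⟨p1, p2, p3⟩ := isStabilizingSolution_iff.1 (isStabilizingSolution_ricc hS hK)
  obtain ⟨q1, q2, q3⟩ := isStabilizingSolution_iff.1 (isStabilizingSolution_ricc hS hK')
  have p4 := riccati_of_stationary p2 (hRK h)
  have q4 := riccati_of_stationary q2 (hRK h')
  have hP := PosSemidef.transpose_eq p1
  have hcr : ∀ {L : Matrix (Fin d) (Fin m) ℝ}, S.R * L = S.Bᵀ * S.ricc L →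
      (S.B * K)ᵀ * S.ricc L = S.ricc K * (S.B * L) := by
    intro L hL
    have e := congrArg Matrix.transpose (hRK h)
    rw [Matrix.transpose_mul, Matrix.transpose_mul, R_transpose, hP, Matrix.transpose_transpose]
      at e
    rw [Matrix.transpose_mul, Matrix.mul_assoc, ← hL, ← Matrix.mul_assoc, e, Matrix.mul_assoc]
  have hPP : S.ricc K = S.ricc K' := by
    refine sub_eq_zero.1 (sylvester_zero p3 q3 ?_)
    have e : (S.A - S.B * K + S.G * S.Gᵀ * S.ricc K)ᵀ
        = S.Aᵀ - (S.B * K)ᵀ + S.ricc K * (S.G * S.Gᵀ) := by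
      simp only [Matrix.transpose_add, Matrix.transpose_sub, Matrix.transpose_mul, hP,
        Matrix.transpose_transpose]
    rw [← sub_eq_zero.2 (p4.trans q4.symm), e, Matrix.mul_sub, Matrix.add_mul, Matrix.add_mul,
      Matrix.sub_mul, Matrix.sub_mul, hcr (hRK h), hcr (hRK h')]
    noncomm_ring
  rw [h, h', hPP]

/-- The effect of a gain update `K ↦ K - c T (R K - Bᵀ P)` on the Riccati expression. -/
theorem riccati_step {K T : Matrix _ _ ℝ} {P : Matrix (Fin m) (Fin m) ℝ} {c : ℝ} (hP : Pᵀ = P)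
    (hT : Tᵀ = T) {E : Matrix (Fin d) (Fin m) ℝ} (hE : E = S.R * K - S.Bᵀ * P) :
    (S.A - S.B * (K - c • (T * E)))ᵀ * P + P * (S.A - S.B * (K - c • (T * E)))
        + S.outputGram (K - c • (T * E)) + P * (S.G * S.Gᵀ) * P
        + c • (Eᵀ * T * E + Eᵀ * (T - c • (T * S.R * T)) * E)
      = (S.A - S.B * K)ᵀ * P + P * (S.A - S.B * K) + S.outputGram K + P * (S.G * S.Gᵀ) * P := by
  have hEt : Eᵀ = Kᵀ * S.R - P * S.B := by
    rw [hE, Matrix.transpose_sub, Matrix.transpose_mul, Matrix.transpose_mul, R_transpose, hP,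
      Matrix.transpose_transpose]
  have e1 : Eᵀ * T * (S.R * K) = Eᵀ * T * E + Eᵀ * T * (S.Bᵀ * P) := by
    rw [← Matrix.mul_add, hE]
    abel_nf
  have e2 : Kᵀ * S.R * (T * E) = Eᵀ * (T * E) + P * S.B * (T * E) := by
    rw [← Matrix.add_mul, hEt]
    abel_nf
  rw [← sub_eq_zero]
  simp only [outputGram, Matrix.transpose_sub, Matrix.transpose_mul, Matrix.transpose_smul, hT,
    Matrix.mul_sub, Matrix.sub_mul, Matrix.mul_smul, Matrix.smul_mul] at *
  simp only [← Matrix.mul_assoc] at *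
  rw [e1, e2]
  module

/-- One step from a feasible gain: the next gain is feasible, its Riccati solution is smaller, and
the gradient is controlled by the decrease. -/
theorem step_spec (hS : S.Standing) {K : Matrix (Fin d) (Fin m) ℝ} (hK : K ∈ S.feasible)
    {T : Matrix (Fin d) (Fin d) ℝ} {c : ℝ} (hc : 0 < c) (hT : T.PosSemidef)
    (hTc : (T - c • (T * S.R * T)).PosSemidef) {K' : Matrix (Fin d) (Fin m) ℝ}
    (hK' : K' = K - c • (T * S.grad K)) :
    K' ∈ S.feasible ∧ (S.ricc K - S.ricc K').PosSemidef ∧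
      c * ((S.grad K)ᵀ * T * S.grad K).trace ≤
        -2 * ((S.ricc K - S.ricc K') * (S.A - S.B * K' + S.G * S.Gᵀ * S.ricc K')).trace := by
  obtain ⟨p1, p2, p3⟩ := isStabilizingSolution_iff.1 (isStabilizingSolution_ricc hS hK)
  have hP := PosSemidef.transpose_eq p1
  have hGG := posSemidef_mul_transpose_self S.G
  have hstep := riccati_step (c := c) hP (PosSemidef.transpose_eq hT) (E := S.grad K) rfl
  rw [← hK', p2] at hstep
  set E := S.grad K with hE
  set M := c • (Eᵀ * T * E + Eᵀ * (T - c • (T * S.R * T)) * E) with hM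
  have hM1 := PosSemidef.congr hT E
  have hM2 := PosSemidef.congr hTc E
  have hMp : M.PosSemidef := (hM1.add hM2).smul hc.le
  have hfeas : K' ∈ S.feasible := by
    -- `M X = 0` forces `T E X = 0`, so `K' X = K X` and on such `X` the new loop agrees with the
    -- Hurwitz loop of `K`.
    refine mem_feasible_of_dissipation hS p1 hMp hstep p3 fun X hX => ?_
    have h0 : (Xᵀ * (Eᵀ * T * E + Eᵀ * (T - c • (T * S.R * T)) * E) * X).trace = 0 := by
      rw [hM, Matrix.smul_mul, smul_eq_zero] at hX
      rw [Matrix.mul_assoc, hX.resolve_left hc.ne', Matrix.mul_zero, Matrix.trace_zero]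
    rw [Matrix.mul_add, Matrix.add_mul, Matrix.trace_add] at h0
    have h1 := PosSemidef.trace_congr_nonneg hM1 X
    have h2 := PosSemidef.trace_congr_nonneg hM2 X
    have h3 : ((E * X)ᵀ * T * (E * X)).trace = 0 := by
      rw [Matrix.transpose_mul]
      have : (Xᵀ * (Eᵀ * T * E) * X).trace = 0 := by linarith
      simpa only [Matrix.mul_assoc] using this
    have h4 := PosSemidef.mul_eq_zero_of_trace hT h3
    rw [hK', Matrix.mul_sub, Matrix.mul_smul]
    simp only [Matrix.add_mul, Matrix.sub_mul, Matrix.smul_mul, Matrix.mul_assoc, h4,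
      Matrix.mul_zero, smul_zero, sub_zero]
  have hq := isStabilizingSolution_iff.1 (isStabilizingSolution_ricc hS hfeas)
  have hQ := PosSemidef.transpose_eq hq.1
  have hX := sub_posSemidef_of_riccati hGG hq hP hMp hstep
  refine ⟨hfeas, hX, ?_⟩
  have hd := riccati_sub (PosSemidef.transpose_eq hGG) hQ hq.2.1 hstep
  set X := S.ricc K - S.ricc K' with hXdef
  have hXt := PosSemidef.transpose_eq hX
  set F := S.A - S.B * K' + S.G * S.Gᵀ * S.ricc K' with hF
  -- Taking traces bounds `tr M` by `-2 tr (X F)`, the term quadratic in `X` being nonnegative.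
  have ht := congrArg Matrix.trace hd
  have e1 : (Fᵀ * X).trace = (X * F).trace := by
    rw [trace_transpose_mul_comm, hXt]
  have e2 : 0 ≤ (X * (S.G * S.Gᵀ) * X).trace := by
    have := PosSemidef.trace_congr_nonneg hGG X
    rwa [hXt] at this
  have e3 : M.trace = c * ((Eᵀ * T * E).trace + (Eᵀ * (T - c • (T * S.R * T)) * E).trace) := by
    rw [hM, Matrix.trace_smul, Matrix.trace_add, smul_eq_mul]
  rw [Matrix.trace_add, Matrix.trace_add, Matrix.trace_add, e1, e3, Matrix.trace_zero] at ht
  have e4 := mul_nonneg hc.le hM2.trace_nonneg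
  linarith

end Problem

/-! ### Convergence of the iteration -/

theorem summable_of_telescope {x y : ℕ → ℝ} (hx : ∀ k, 0 ≤ x k) (hy : ∀ k, 0 ≤ y k)
    (h : ∀ k, x k = y k - y (k + 1)) :
    Summable x ∧ ∀ N, ∑ k ∈ Finset.range N, x k ≤ y 0 := by
  have hs : ∀ N, ∑ k ∈ Finset.range N, x k ≤ y 0 := by
    intro N
    rw [Finset.sum_congr rfl fun k _ => h k, Finset.sum_range_sub']
    linarith [hy N]
  exact ⟨summable_of_sum_range_le hx hs, hs⟩

/-- If `e² ≤ x² (a + b e)` with `x` bounded, then `e` is bounded by a multiple of `x`. -/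
theorem exists_linear_bound {e x : ℕ → ℝ} {a b r : ℝ} (ha : 0 ≤ a) (hb : 0 ≤ b)
    (hx : ∀ k, 0 ≤ x k) (hxr : ∀ k, x k ≤ r)
    (h : ∀ k, e k ^ 2 ≤ x k ^ 2 * (a + b * e k)) : ∃ c, 0 ≤ c ∧ ∀ k, e k ≤ c * x k := by
  -- A crude bound comes first: where `e ≥ 1`, the hypothesis gives `e² ≤ r² (a + b) e`. Fed back,
  -- it makes the factor `a + b e` bounded by `s`.
  have hbd : ∀ k, e k ≤ 1 + r ^ 2 * (a + b) := by
    intro k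
    by_contra hlt
    push Not at hlt
    have hr : 0 ≤ r ^ 2 * (a + b) := by positivity
    have h1 : 1 ≤ e k := by linarith
    have h2 : x k ^ 2 ≤ r ^ 2 := pow_le_pow_left₀ (hx k) (hxr k) 2
    have h3 : a + b * e k ≤ (a + b) * e k := by nlinarith
    have h4 : x k ^ 2 * (a + b * e k) ≤ r ^ 2 * ((a + b) * e k) :=
      mul_le_mul h2 h3 (by positivity) (by positivity)
    nlinarith [h k]
  set s := a + b * (1 + r ^ 2 * (a + b)) with hs
  have hs0 : 0 ≤ s := by positivity
  refine ⟨Real.sqrt s, Real.sqrt_nonneg s, fun k => ?_⟩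
  refine le_of_abs_le (abs_le_of_sq_le_sq ?_ (mul_nonneg (Real.sqrt_nonneg s) (hx k)))
  rw [mul_pow, Real.sq_sqrt hs0]
  calc e k ^ 2 ≤ x k ^ 2 * (a + b * e k) := h k
    _ ≤ x k ^ 2 * s := by
      refine mul_le_mul_of_nonneg_left ?_ (sq_nonneg _)
      have := mul_le_mul_of_nonneg_left (hbd k) hb
      linarith
    _ = s * x k ^ 2 := mul_comm _ _

open scoped Matrix.Norms.Frobenius in
theorem tendsto_zero_of_frobSq {p q : ℕ} {E : ℕ → Matrix (Fin p) (Fin q) ℝ}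
    (h : Tendsto (fun k => frobSq (E k)) atTop (𝓝 0)) : Tendsto E atTop (𝓝 0) := by
  refine tendsto_zero_iff_norm_tendsto_zero.2 ?_
  have h2 := (Real.continuous_sqrt.tendsto 0).comp h
  rw [Real.sqrt_zero] at h2
  refine h2.congr fun k => ?_
  rw [Function.comp_apply, frobSq_eq_norm_sq, Real.sqrt_sq (norm_nonneg _)]

open scoped Matrix.Norms.Frobenius in
/-- A decreasing sequence of positive semidefinite matrices converges. -/
theorem exists_tendsto_of_sub_posSemidef {p : ℕ} {P : ℕ → Matrix (Fin p) (Fin p) ℝ}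
    (hP : ∀ k, (P k - P (k + 1)).PosSemidef) (hs : Summable fun k => (P k - P (k + 1)).trace) :
    ∃ P', Tendsto P atTop (𝓝 P') := by
  refine cauchySeq_tendsto_of_complete (cauchySeq_of_dist_le_of_summable _ (fun k => ?_) hs)
  rw [dist_eq_norm]
  refine le_of_abs_le (abs_le_of_sq_le_sq ?_ (hP k).trace_nonneg)
  rw [← frobSq_eq_norm_sq]
  exact PosSemidef.frobSq_le (hP k)

open scoped Matrix.Norms.L2Operator in
theorem posSemidef_one_sub_smul {p : ℕ} {R : Matrix (Fin p) (Fin p) ℝ} (hR : R.PosSemidef)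
    {c : ℝ} (hc : 0 ≤ c) (h : c * opNorm R ≤ 1) :
    ((1 : Matrix (Fin p) (Fin p) ℝ) - c • R).PosSemidef := by
  refine Matrix.PosSemidef.of_dotProduct_mulVec_nonneg ?_ fun x => ?_
  · simp [Matrix.IsHermitian, PosSemidef.transpose_eq hR]
  · have h1 := Matrix.l2_opNorm_mulVec R (WithLp.toLp 2 x)
    have h2 := real_inner_le_norm (WithLp.toLp 2 x) (WithLp.toLp 2 (R *ᵥ x))
    have h3 : inner ℝ (WithLp.toLp 2 x) (WithLp.toLp 2 (R *ᵥ x)) = x ⬝ᵥ R *ᵥ x := by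
      simp [PiLp.inner_apply, dotProduct, mul_comm]
    have h4 : ‖WithLp.toLp 2 x‖ ^ 2 = x ⬝ᵥ x := by
      rw [EuclideanSpace.norm_sq_eq]
      simp [dotProduct, sq]
    have h5 : ‖WithLp.toLp 2 (R *ᵥ x)‖ ≤ opNorm R * ‖WithLp.toLp 2 x‖ := h1
    have h6 : x ⬝ᵥ R *ᵥ x ≤ opNorm R * (x ⬝ᵥ x) := by
      rw [← h3, ← h4]
      nlinarith [norm_nonneg (WithLp.toLp 2 x)]
    have h7 : 0 ≤ x ⬝ᵥ x := by rw [← h4]; positivity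
    rw [star_trivial, Matrix.sub_mulVec, Matrix.one_mulVec, Matrix.smul_mulVec, dotProduct_sub,
      dotProduct_smul, smul_eq_mul]
    nlinarith [mul_le_mul_of_nonneg_left h6 hc]

namespace Problem

variable {m d n l : ℕ} {S : Problem m d n l}

theorem inv_R_mul_grad (hS : S.Standing) (K : Matrix (Fin d) (Fin m) ℝ) :
    K = S.R⁻¹ * (S.grad K + S.Bᵀ * S.ricc K) := by
  rw [grad, sub_add_cancel, Matrix.nonsing_inv_mul_cancel_left _ _ (isUnit_R hS)]

/-- Along the iteration, the squared gradient norm is at most a multiple of the decrease of the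
trace of the Riccati solution. -/
theorem exists_grad_bound (hS : S.Standing) {T : Matrix (Fin d) (Fin d) ℝ} {c : ℝ} (hc : 0 < c)
    (hT : T.PosDef) (hTc : (T - c • (T * S.R * T)).PosSemidef)
    {K : ℕ → Matrix (Fin d) (Fin m) ℝ} (hK : ∀ k, K k ∈ S.feasible)
    (hstep : ∀ k, K (k + 1) = K k - c • (T * S.grad (K k)))
    (htr : ∀ k, (S.ricc (K k)).trace ≤ (S.ricc (K 0)).trace) :
    ∃ a, 0 ≤ a ∧ ∀ k, frobSq (S.grad (K k))
      ≤ a * (S.ricc (K k) - S.ricc (K (k + 1))).trace := by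
  have hpsd : ∀ k, (S.ricc (K k)).PosSemidef := fun k =>
    (isStabilizingSolution_ricc hS (hK k)).1
  have hX : ∀ k, (S.ricc (K k) - S.ricc (K (k + 1))).PosSemidef := fun k =>
    (step_spec hS (hK k) hc hT.posSemidef hTc (hstep k)).2.1
  have hdec := fun k => (step_spec hS (hK k) hc hT.posSemidef hTc (hstep k)).2.2
  obtain ⟨τ, hτ, hTτ⟩ := PosDef.exists_lower_bound hT
  set r := (S.ricc (K 0)).trace ^ 2 with hr
  have hPr : ∀ k, frobSq (S.ricc (K k)) ≤ r := fun k =>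
    (PosSemidef.frobSq_le (hpsd k)).trans (pow_le_pow_left₀ (hpsd k).trace_nonneg (htr k) 2)
  set V := -(S.B * (S.R⁻¹ - c • T)) with hV
  -- These bound the next closed loop by the gradient. Substituting `K = R⁻¹ (E + Bᵀ P)` avoids any
  -- prior bound on the gains; the factors 2 come from `frobSq_add_le`.
  set b₁ := 2 * (2 * frobSq S.A
    + 2 * (2 * (frobSq (-(S.B * S.R⁻¹ * S.Bᵀ)) * r) + 2 * (frobSq (S.G * S.Gᵀ) * r))) with hb₁
  set b₂ := 2 * frobSq V with hb₂
  have hr0 : 0 ≤ r := sq_nonneg _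
  have hb₁0 : 0 ≤ b₁ := by
    have h1 := frobSq_nonneg S.A
    have h2 := frobSq_nonneg (-(S.B * S.R⁻¹ * S.Bᵀ))
    have h3 := frobSq_nonneg (S.G * S.Gᵀ)
    positivity
  have hb₂0 : 0 ≤ b₂ := mul_nonneg zero_le_two (frobSq_nonneg _)
  have hF : ∀ k, frobSq (S.A - S.B * K (k + 1) + S.G * S.Gᵀ * S.ricc (K (k + 1)))
      ≤ b₁ + b₂ * frobSq (S.grad (K k)) := by
    intro k
    have e : S.A - S.B * K (k + 1) + S.G * S.Gᵀ * S.ricc (K (k + 1))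
        = (S.A + (-(S.B * S.R⁻¹ * S.Bᵀ) * S.ricc (K k)
            + S.G * S.Gᵀ * S.ricc (K (k + 1)))) + V * S.grad (K k) := by
      rw [hstep k, hV]
      nth_rewrite 1 [inv_R_mul_grad hS (K k)]
      simp only [Matrix.mul_add, Matrix.sub_mul, Matrix.mul_sub, Matrix.neg_mul, Matrix.mul_assoc, Matrix.smul_mul]
      abel
    rw [e]
    have i1 := frobSq_add_le (S.A + (-(S.B * S.R⁻¹ * S.Bᵀ) * S.ricc (K k)
      + S.G * S.Gᵀ * S.ricc (K (k + 1)))) (V * S.grad (K k))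
    have i2 := frobSq_add_le S.A (-(S.B * S.R⁻¹ * S.Bᵀ) * S.ricc (K k)
      + S.G * S.Gᵀ * S.ricc (K (k + 1)))
    have i3 := frobSq_add_le (-(S.B * S.R⁻¹ * S.Bᵀ) * S.ricc (K k))
      (S.G * S.Gᵀ * S.ricc (K (k + 1)))
    have i4 := frobSq_mul_le (-(S.B * S.R⁻¹ * S.Bᵀ)) (S.ricc (K k))
    have i5 := frobSq_mul_le (S.G * S.Gᵀ) (S.ricc (K (k + 1)))
    have i6 := frobSq_mul_le V (S.grad (K k))
    have i7 := mul_le_mul_of_nonneg_left (hPr k) (frobSq_nonneg (-(S.B * S.R⁻¹ * S.Bᵀ)))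
    have i8 := mul_le_mul_of_nonneg_left (hPr (k + 1)) (frobSq_nonneg (S.G * S.Gᵀ))
    rw [hb₁, hb₂]
    linarith
  have hxr : ∀ k, 2 / (c * τ) * (S.ricc (K k) - S.ricc (K (k + 1))).trace
      ≤ 2 / (c * τ) * (S.ricc (K 0)).trace := by
    intro k
    refine mul_le_mul_of_nonneg_left ?_ (by positivity)
    have h1 := (hpsd (k + 1)).trace_nonneg
    have h2 := htr k
    rw [Matrix.trace_sub]
    linarith
  -- From `c τ ‖E‖² ≤ -2 tr (X F)`, Cauchy–Schwarz and `‖X‖ ≤ tr X`, one gets `‖E‖⁴ ≤ (2 tr X / (c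
  -- τ))² ‖F‖²`.
  obtain ⟨a, ha, hab⟩ := exists_linear_bound (e := fun k => frobSq (S.grad (K k)))
    (x := fun k => 2 / (c * τ) * (S.ricc (K k) - S.ricc (K (k + 1))).trace) hb₁0 hb₂0
    (fun k => mul_nonneg (by positivity) (hX k).trace_nonneg) hxr fun k => by
      have h1 : τ * frobSq (S.grad (K k)) ≤ ((S.grad (K k))ᵀ * T * S.grad (K k)).trace := by
        have := PosSemidef.trace_congr_nonneg hTτ (S.grad (K k))
        rw [Matrix.mul_sub, Matrix.sub_mul, Matrix.trace_sub, Matrix.mul_smul, Matrix.mul_one,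
          Matrix.smul_mul, Matrix.trace_smul, ← frobSq_eq_trace, smul_eq_mul] at this
        linarith
      have h2 := (mul_le_mul_of_nonneg_left h1 hc.le).trans (hdec k)
      have h3 := trace_mul_sq_le (S.ricc (K k) - S.ricc (K (k + 1)))
        (S.A - S.B * K (k + 1) + S.G * S.Gᵀ * S.ricc (K (k + 1)))
      have h4 := mul_le_mul (PosSemidef.frobSq_le (hX k)) (hF k) (frobSq_nonneg _) (sq_nonneg _)
      set z := ((S.ricc (K k) - S.ricc (K (k + 1)))
        * (S.A - S.B * K (k + 1) + S.G * S.Gᵀ * S.ricc (K (k + 1)))).trace with hz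
      set e := frobSq (S.grad (K k)) with he
      have he0 : 0 ≤ c * (τ * e) := mul_nonneg hc.le (mul_nonneg hτ.le (frobSq_nonneg _))
      have h5 : (c * (τ * e)) ^ 2 ≤ (-2 * z) ^ 2 := pow_le_pow_left₀ he0 h2 2
      have h6 : e ^ 2 = (c * (τ * e)) ^ 2 / (c * τ) ^ 2 := by
        field_simp
      rw [h6, div_le_iff₀ (by positivity)]
      calc (c * (τ * e)) ^ 2 ≤ 4 * z ^ 2 := by linarith
        _ ≤ 4 * ((S.ricc (K k) - S.ricc (K (k + 1))).trace ^ 2 * (b₁ + b₂ * e)) := by linarith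
        _ = _ := by field_simp; ring
  refine ⟨a * (2 / (c * τ)), by positivity, fun k => ?_⟩
  rw [mul_assoc]
  exact hab k

/-- A stationary limit of gains with their stabilizing solutions is stabilizing. -/
theorem isStabilizingSolution_of_tendsto (hS : S.Standing) (hdet : IsDetectable S.A S.C)
    {K₀ : Matrix (Fin d) (Fin m) ℝ} (hK₀ : K₀ ∈ S.feasible) {K : ℕ → Matrix (Fin d) (Fin m) ℝ}
    {Pk : ℕ → Matrix (Fin m) (Fin m) ℝ} (h : ∀ k, S.IsStabilizingSolution (K k) (Pk k))
    {K' : Matrix (Fin d) (Fin m) ℝ} {P : Matrix (Fin m) (Fin m) ℝ}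
    (hK : Tendsto K atTop (𝓝 K')) (hP : Tendsto Pk atTop (𝓝 P)) (hRK' : S.R * K' = S.Bᵀ * P) :
    S.IsStabilizingSolution K' P := by
  have hst := fun k => isStabilizingSolution_iff.1 (h k)
  have hPp : P.PosSemidef :=
    (isClosed_posSemidef m).mem_of_tendsto hP (Eventually.of_forall fun k => (hst k).1)
  have hF : Tendsto (fun k => S.A - S.B * K k) atTop (𝓝 (S.A - S.B * K')) := by
    have hc : Continuous fun L : Matrix (Fin d) (Fin m) ℝ => S.A - S.B * L := by fun_prop
    exact (hc.tendsto K').comp hK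
  have hFt : Tendsto (fun k => (S.A - S.B * K k)ᵀ) atTop (𝓝 (S.A - S.B * K')ᵀ) :=
    (continuous_id.matrix_transpose.tendsto _).comp hF
  have hQ : Tendsto (fun k => S.outputGram (K k)) atTop (𝓝 (S.outputGram K')) := by
    have hc : Continuous S.outputGram := by
      unfold outputGram
      fun_prop
    exact (hc.tendsto K').comp hK
  have hR : (S.A - S.B * K')ᵀ * P + P * (S.A - S.B * K') + S.outputGram K'
      + P * (S.G * S.Gᵀ) * P = 0 := by
    refine tendsto_nhds_unique ?_ (tendsto_const_nhds (f := atTop (α := ℕ)))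
    refine Tendsto.congr (fun k => (hst k).2.1) ?_
    exact (((hFt.mul hP).add (hP.mul hF)).add hQ).add ((hP.mul_const _).mul hP)
  exact isStabilizingSolution_iff.2 ⟨hPp, hR,
    isHurwitz_of_tendsto (fun k => (hst k).2.2) (hF.add (hP.const_mul _)) fun ω X hX =>
      eq_zero_of_stationary hS hdet hK₀ (PosSemidef.transpose_eq hPp) hR hRK' hX⟩

/-- Convergence of the iteration `K ↦ K - c T (R K - Bᵀ P_K)` to a stationary gain. -/
theorem exists_convergesWithRate (hS : S.Standing) (hdet : IsDetectable S.A S.C)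
    {T : Matrix (Fin d) (Fin d) ℝ} {c : ℝ} (hc : 0 < c) (hT : T.PosDef)
    (hTc : (T - c • (T * S.R * T)).PosSemidef) {K : ℕ → Matrix (Fin d) (Fin m) ℝ}
    (h0 : K 0 ∈ S.feasible) (hstep : ∀ k, K (k + 1) = K k - c • (T * S.grad (K k))) :
    ∃ K' ∈ S.feasible, K' = S.R⁻¹ * S.Bᵀ * S.ricc K' ∧ S.ConvergesWithRate K K' ∧
      (S.ricc (K 0) - S.ricc K').PosSemidef := by
  have hK : ∀ k, K k ∈ S.feasible := by
    intro k
    induction k with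
    | zero => exact h0
    | succ k ih => exact (step_spec hS ih hc hT.posSemidef hTc (hstep k)).1
  have hX : ∀ k, (S.ricc (K k) - S.ricc (K (k + 1))).PosSemidef := fun k =>
    (step_spec hS (hK k) hc hT.posSemidef hTc (hstep k)).2.1
  have hstab := fun k => isStabilizingSolution_ricc hS (hK k)
  have hmono : ∀ k, (S.ricc (K 0) - S.ricc (K k)).PosSemidef := by
    intro k
    induction k with
    | zero => rw [sub_self]; exact Matrix.PosSemidef.zero
    | succ k ih =>
      have := ih.add (hX k)
      rwa [sub_add_sub_cancel] at this
  have htr : ∀ k, (S.ricc (K k)).trace ≤ (S.ricc (K 0)).trace := fun k => by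
    have := (hmono k).trace_nonneg
    rwa [Matrix.trace_sub, sub_nonneg] at this
  obtain ⟨a, ha, hab⟩ := exists_grad_bound hS hc hT hTc hK hstep htr
  obtain ⟨hsum, hsle⟩ := summable_of_telescope
    (x := fun k => (S.ricc (K k) - S.ricc (K (k + 1))).trace)
    (y := fun k => (S.ricc (K k)).trace) (fun k => (hX k).trace_nonneg)
    (fun k => (hstab k).1.trace_nonneg) fun k => Matrix.trace_sub _ _
  obtain ⟨P, hP⟩ := exists_tendsto_of_sub_posSemidef hX hsum
  have hgrad : Tendsto (fun k => S.grad (K k)) atTop (𝓝 0) := by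
    refine tendsto_zero_of_frobSq (squeeze_zero (fun k => frobSq_nonneg _) hab ?_)
    simpa using hsum.tendsto_atTop_zero.const_mul a
  -- The gains inherit convergence from `K = R⁻¹ (E + Bᵀ P)`, since `E` tends to zero and `P`
  -- converges.
  have hKl : Tendsto K atTop (𝓝 (S.R⁻¹ * (0 + S.Bᵀ * P))) := by
    have hc1 : Continuous fun x : Matrix (Fin d) (Fin m) ℝ × Matrix (Fin m) (Fin m) ℝ =>
        S.R⁻¹ * (x.1 + S.Bᵀ * x.2) := by fun_prop
    have := (hc1.tendsto (0, P)).comp (hgrad.prodMk_nhds hP)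
    refine this.congr fun k => ?_
    exact (inv_R_mul_grad hS (K k)).symm
  set K' := S.R⁻¹ * (0 + S.Bᵀ * P) with hK'
  have hK'e : K' = S.R⁻¹ * S.Bᵀ * P := by rw [hK', zero_add, Matrix.mul_assoc]
  have hRK' : S.R * K' = S.Bᵀ * P := by
    rw [hK'e, Matrix.mul_assoc, Matrix.mul_nonsing_inv_cancel_left _ _ (isUnit_R hS)]
  have hst' := isStabilizingSolution_of_tendsto hS hdet h0 hstab hKl hP hRK'
  have hric : S.ricc K' = P := ricc_eq hst'
  refine ⟨K', hst'.mem_feasible hS, by rw [hric]; exact hK'e, ⟨fun k => ⟨hK k, hstab k⟩, hKl,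
    a * (S.ricc (K 0)).trace, fun N hN => ?_⟩, ?_⟩
  · rw [mul_comm]
    refine mul_le_mul_of_nonneg_right ?_ (by positivity)
    calc ∑ k ∈ Finset.range N, frobSq (S.R * K k - S.Bᵀ * S.ricc (K k))
        ≤ ∑ k ∈ Finset.range N, a * (S.ricc (K k) - S.ricc (K (k + 1))).trace :=
          Finset.sum_le_sum fun k _ => hab k
      _ = a * ∑ k ∈ Finset.range N, (S.ricc (K k) - S.ricc (K (k + 1))).trace :=
          (Finset.mul_sum _ _ _).symm
      _ ≤ _ := mul_le_mul_of_nonneg_left (hsle N) ha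
  · rw [hric]
    exact (isClosed_posSemidef m).mem_of_tendsto (tendsto_const_nhds.sub hP)
      (Eventually.of_forall hmono)

theorem exists_convergesWithRate_npg (hS : S.Standing) (hdet : IsDetectable S.A S.C)
    {K₀ : Matrix (Fin d) (Fin m) ℝ} (hK₀ : K₀ ∈ S.feasible) {η : ℝ} (hη : 0 < η)
    (hη' : 2 * η * opNorm S.R ≤ 1) :
    ∃ K' ∈ S.feasible, K' = S.R⁻¹ * S.Bᵀ * S.ricc K' ∧
      S.ConvergesWithRate (fun k => (S.npgStep η)^[k] K₀) K' := by
  obtain ⟨K', h1, h2, h3, -⟩ := exists_convergesWithRate hS hdet (T := 1) (c := 2 * η)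
    (K := fun k => (S.npgStep η)^[k] K₀) (by positivity) Matrix.PosDef.one
    (by
      rw [Matrix.one_mul, Matrix.mul_one]
      exact posSemidef_one_sub_smul posSemidef_R (by positivity) hη') hK₀
    (fun k => by rw [Function.iterate_succ_apply', npgStep, Matrix.one_mul, grad])
  exact ⟨K', h1, h2, h3⟩

theorem exists_convergesWithRate_gn (hS : S.Standing) (hdet : IsDetectable S.A S.C)
    {K₀ : Matrix (Fin d) (Fin m) ℝ} (hK₀ : K₀ ∈ S.feasible) {η : ℝ} (hη : 0 < η)
    (hη' : η ≤ 1 / 2) :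
    ∃ K' ∈ S.feasible, K' = S.R⁻¹ * S.Bᵀ * S.ricc K' ∧
      S.ConvergesWithRate (fun k => (S.gnStep η)^[k] K₀) K' ∧
      (S.ricc K₀ - S.ricc K').PosSemidef :=
  exists_convergesWithRate hS hdet (T := S.R⁻¹) (c := 2 * η)
    (K := fun k => (S.gnStep η)^[k] K₀) (by positivity) hS.2.2.inv
    (by
      -- For `T = R⁻¹` the matrix `T - c T R T` is `(1 - 2 η) R⁻¹`.
      rw [Matrix.nonsing_inv_mul _ (isUnit_R hS), Matrix.one_mul]
      have := (hS.2.2.inv).posSemidef.smul (show (0 : ℝ) ≤ 1 - 2 * η by linarith)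
      rwa [sub_smul, one_smul] at this) hK₀
    (fun k => by
      rw [Function.iterate_succ_apply', gnStep, grad, Matrix.mul_sub,
        Matrix.nonsing_inv_mul_cancel_left _ _ (isUnit_R hS), Matrix.mul_assoc])

theorem cost_le_of_sub_posSemidef {K K' : Matrix (Fin d) (Fin m) ℝ}
    (h : (S.ricc K - S.ricc K').PosSemidef) : S.cost K' ≤ S.cost K := by
  have h1 := PosSemidef.trace_congr_nonneg h S.D
  have e : ∀ P : Matrix (Fin m) (Fin m) ℝ, (P * S.D * S.Dᵀ).trace = (S.Dᵀ * P * S.D).trace := by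
    intro P
    rw [Matrix.trace_mul_comm, Matrix.mul_assoc]
  rw [Matrix.mul_sub, Matrix.sub_mul, Matrix.trace_sub] at h1
  rw [cost, cost, e, e]
  linarith

end Problem

end MixedDesign

theorem theoremA2 {m d n l : ℕ} (S : MixedDesign.Problem m d n l) (hS : S.Standing)
    (hdet : MixedDesign.IsDetectable S.A S.C)
    (K₀ : Matrix (Fin d) (Fin m) ℝ) (hK₀ : K₀ ∈ S.feasible) :
    ∃ Kstar ∈ S.feasible,
      (∀ K ∈ S.feasible, S.cost Kstar ≤ S.cost K) ∧
      Kstar = S.R⁻¹ * S.Bᵀ * S.ricc Kstar ∧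
      (∀ K ∈ S.feasible, K = S.R⁻¹ * S.Bᵀ * S.ricc K → K = Kstar) ∧
      (∀ η : ℝ, 0 < η → 2 * η * MixedDesign.opNorm S.R ≤ 1 →
        S.ConvergesWithRate (fun k => (S.npgStep η)^[k] K₀) Kstar) ∧
      (∀ η : ℝ, 0 < η → η ≤ 1 / 2 →
        S.ConvergesWithRate (fun k => (S.gnStep η)^[k] K₀) Kstar) := by
  obtain ⟨Kstar, hfeas, hstat, -, -⟩ :=
    MixedDesign.Problem.exists_convergesWithRate_gn hS hdet hK₀ one_half_pos le_rfl
  have huniq : ∀ K ∈ S.feasible, K = S.R⁻¹ * S.Bᵀ * S.ricc K → K = Kstar := fun K hK h =>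
    MixedDesign.Problem.stationary_unique hS hK hfeas h hstat
  refine ⟨Kstar, hfeas, fun K hK => ?_, hstat, huniq, fun η hη hη' => ?_, fun η hη hη' => ?_⟩
  · obtain ⟨K', h1, h2, -, h3⟩ :=
      MixedDesign.Problem.exists_convergesWithRate_gn hS hdet hK one_half_pos le_rfl
    rw [← huniq K' h1 h2]
    exact MixedDesign.Problem.cost_le_of_sub_posSemidef h3
  · obtain ⟨K', h1, h2, h3⟩ :=
      MixedDesign.Problem.exists_convergesWithRate_npg hS hdet hK₀ hη hη'
    rwa [huniq K' h1 h2] at h3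
  · obtain ⟨K', h1, h2, h3, -⟩ :=
      MixedDesign.Problem.exists_convergesWithRate_gn hS hdet hK₀ hη hη'
    rwa [huniq K' h1 h2] at h3
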